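/- Let $f\colon\mathbb{C}\to\mathbb{C}$ be an entire function and let $f^n$ denote its $n$-th iterate ($f^0=\mathrm{id}$). The Fatou set $F(f)$ is the set of points of $\mathbb{C}$ having a neighbourhood on which the iterates $\{f^n\}_{n\in\mathbb{N}}$ form a normal family (locally uniform convergence of subsequences to $\infty$ being allowed). A wandering domain of $f$ is a connected component $U$ of $F(f)$ such that $f^n(U)\cap f^m(U)\neq\emptyset$ only when $n=m$. A domain is a nonempty connected open subset of $\mathbb{C}$, and an entire function is transcendental if it is not a polynomial. Suppose that $\lambda\in[0,1]$. Then there are a transcendental entire function $f$, a wandering domain $U$ of $f$, and a bounded domain $D\subset\mathbb{C}$ such that $$\lim_{k\to\infty}\frac{\#\{n\le k : f^n(U)\subset D\}}{k}=\lambda .$$ -/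

import Mathlib

open Filter Topology

/-- A domain in the complex plane: a nonempty connected open set. -/
def IsPlaneDomain (D : Set ℂ) : Prop :=
  IsOpen D ∧ IsConnected D

/-- A transcendental entire function: holomorphic on all of `ℂ` and not a polynomial. -/
def IsTranscendentalEntire (f : ℂ → ℂ) : Prop :=
  Differentiable ℂ f ∧ ¬ ∃ p : Polynomial ℂ, ∀ z, f z = p.eval z

/-- The sequence `g` tends to infinity uniformly on every compact subset of `V`. -/
def TendsToInftyOnCompacts (g : ℕ → ℂ → ℂ) (V : Set ℂ) : Prop :=
  ∀ K ⊆ V, IsCompact K → ∀ R : ℝ, ∀ᶠ k in atTop, ∀ z ∈ K, R < ‖g k z‖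

/-- Normality of a family `F` of holomorphic functions on a domain `V`: every sequence of
members of the family has a subsequence that either converges locally uniformly on `V` to a
finite (hence holomorphic) limit, or tends to infinity uniformly on compact subsets of `V`.
As `V` is connected, these two cases make up locally uniform convergence in the spherical
metric. -/
def IsNormalFamilyOn {ι : Type*} (F : ι → ℂ → ℂ) (V : Set ℂ) : Prop :=
  ∀ s : ℕ → ι, ∃ φ : ℕ → ℕ, StrictMono φ ∧
    ((∃ g : ℂ → ℂ, TendstoLocallyUniformlyOn (fun k => F (s (φ k))) g atTop V) ∨
      TendsToInftyOnCompacts (fun k => F (s (φ k))) V)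

/-- The Fatou set of an entire function `f`: the points having a (connected open) neighbourhood
on which the iterates of `f` form a normal family. -/
def fatouSet (f : ℂ → ℂ) : Set ℂ :=
  {z | ∃ V : Set ℂ, IsPlaneDomain V ∧ z ∈ V ∧ IsNormalFamilyOn (fun n : ℕ => f^[n]) V}

/-- `U` is a Fatou component of `f`, that is, a connected component of the Fatou set. -/
def IsFatouComponent (f : ℂ → ℂ) (U : Set ℂ) : Prop :=
  ∃ z ∈ fatouSet f, U = connectedComponentIn (fatouSet f) z

/-- `U` is a wandering domain of `f`: a Fatou component such that `f^n(U)` meets `f^m(U)` only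
when `n = m`. -/
def IsWanderingDomain (f : ℂ → ℂ) (U : Set ℂ) : Prop :=
  IsFatouComponent f U ∧ ∀ n m : ℕ, ((f^[n] '' U) ∩ (f^[m] '' U)).Nonempty → n = m

/-! An entire function is built with a wandering disc that makes infinitely many excursions. The
`k`-th one starts at `port (k + 2)`, jumps near `0`, stays there for `m k` steps, runs through sites
`1, ..., k + 2`, and ends at `port (k + 3)`. Near the sites the map is almost `z ↦ 10000 z`, so an
orbit with any such itinerary exists by pulling its endpoint back (`exists_orbit_of_expanding`).
Near `port 1` the map is almost constant and traps orbits.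

The function is a limit of successive approximations. Each step changes the map very little on a
large disc and prescribes it near a new site and port. The blending function `f + (g - f) *
smoothstep^[n] ∘ q` does this (`exists_entire_blend`). An excursion is a finite-time property with
room to spare, so it survives all later changes (`IsStage.exists_next`).

To keep the Fatou component from being larger than intended, the map near each port is a power map
of high degree. It sends most of the disc close to the chosen orbit, while every point of a thin
collar is close to a point sent to `port 1` (`exists_power_map`). Hence trapped points accumulate at
every boundary point of the set of followers. Followers escape along the start times. On a component
of the Fatou set, escape along a subsequence holds everywhere or nowhere, so the component consists
of followers (`component_subset_followers`). Separation of sites and ports then makes it wander.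

The component is near `0` exactly during the dwelling times, and `m` is arbitrary. What remains is
to choose `m` so that these times have density `lam`, with each single excursion asymptotically
negligible outside its dwelling time (`tendsto_density_dwell`). -/

/-! ### Blending two entire functions -/

/-- The cubic smoothstep polynomial; `0` and `1` are superattracting fixed points. -/
def smoothstep (w : ℂ) : ℂ := 3 * w ^ 2 - 2 * w ^ 3

theorem differentiable_smoothstep : Differentiable ℂ smoothstep := by
  unfold smoothstep; fun_prop

theorem one_sub_smoothstep (w : ℂ) : 1 - smoothstep w = smoothstep (1 - w) := by
  unfold smoothstep; ring

theorem norm_smoothstep_le {w : ℂ} (hw : ‖w‖ ≤ 1 / 8) : ‖smoothstep w‖ ≤ ‖w‖ / 2 := by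
  have h : smoothstep w = w * (w * (3 - 2 * w)) := by unfold smoothstep; ring
  have h1 : ‖(3 : ℂ) - 2 * w‖ ≤ 3 + 2 * ‖w‖ := by
    refine (norm_sub_le _ _).trans ?_
    simp
  rw [h, norm_mul, norm_mul]
  have h0 := norm_nonneg w
  have h2 : ‖w‖ * ‖(3 : ℂ) - 2 * w‖ ≤ 1 / 8 * (3 + 2 * (1 / 8)) :=
    mul_le_mul hw (h1.trans (by linarith)) (norm_nonneg _) (by norm_num)
  nlinarith

theorem norm_smoothstep_iterate_le {w : ℂ} (hw : ‖w‖ ≤ 1 / 8) (n : ℕ) :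
    ‖smoothstep^[n] w‖ ≤ 1 / 8 * (1 / 2) ^ n := by
  induction n with
  | zero => simpa using hw
  | succ n ih =>
    rw [Function.iterate_succ_apply']
    have h1 : ((1 : ℝ) / 2) ^ n ≤ 1 := pow_le_one₀ (by norm_num) (by norm_num)
    refine (norm_smoothstep_le (by linarith)).trans ?_
    rw [pow_succ]; linarith

/-- The symmetry `w ↦ 1 - w` transfers the contraction towards `0` to a contraction towards `1`. -/
theorem one_sub_smoothstep_iterate (w : ℂ) (n : ℕ) :
    1 - smoothstep^[n] w = smoothstep^[n] (1 - w) := by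
  induction n with
  | zero => simp
  | succ n ih =>
    rw [Function.iterate_succ_apply', Function.iterate_succ_apply', one_sub_smoothstep, ih]

/-- Two entire functions can be simultaneously approximated, each on its own compact set, as soon
as some entire function is close to `0` on the first set and to `1` on the second. -/
theorem exists_entire_blend {f g q : ℂ → ℂ} (hf : Differentiable ℂ f) (hg : Differentiable ℂ g)
    (hq : Differentiable ℂ q) {K₀ K₁ : Set ℂ} (h₀ : IsCompact K₀) (h₁ : IsCompact K₁)
    (hq₀ : ∀ z ∈ K₀, ‖q z‖ ≤ 1 / 8) (hq₁ : ∀ z ∈ K₁, ‖q z - 1‖ ≤ 1 / 8) {ε : ℝ} (hε : 0 < ε) :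
    ∃ F : ℂ → ℂ, Differentiable ℂ F ∧ (∀ z ∈ K₀, ‖F z - f z‖ ≤ ε) ∧
      ∀ z ∈ K₁, ‖F z - g z‖ ≤ ε := by
  obtain ⟨M, hM⟩ := (h₀.union h₁).exists_bound_of_continuousOn (f := fun z => g z - f z)
    (hg.sub hf).continuous.continuousOn
  -- The number of iterations is chosen so that `(1 / 2) ^ n` beats the bound for `g - f` on both
  -- compact sets.
  obtain ⟨n, hn⟩ := exists_pow_lt_of_lt_one (show 0 < ε / (|M| + 1) by positivity)
    (show (1 / 2 : ℝ) < 1 by norm_num)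
  have key : ∀ z ∈ K₀ ∪ K₁, ∀ w : ℂ, ‖w‖ ≤ 1 / 8 → ‖(g z - f z) * smoothstep^[n] w‖ ≤ ε := by
    intro z hz w hw
    rw [norm_mul]
    have h2 := norm_smoothstep_iterate_le hw n
    rw [lt_div_iff₀ (by positivity)] at hn
    have h3 : ‖g z - f z‖ ≤ |M| + 1 := (hM z hz).trans ((le_abs_self M).trans (by linarith))
    have h4 : (0 : ℝ) ≤ (1 / 2) ^ n := by positivity
    calc _ ≤ (|M| + 1) * (1 / 2) ^ n :=
          mul_le_mul h3 (by linarith) (norm_nonneg _) (by positivity)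
      _ ≤ ε := by linarith
  have hs : Differentiable ℂ smoothstep^[n] := differentiable_smoothstep.iterate n
  refine ⟨fun z => f z + (g z - f z) * smoothstep^[n] (q z),
    hf.add ((hg.sub hf).mul (hs.comp hq)), fun z hz => ?_, fun z hz => ?_⟩
  · rw [add_sub_cancel_left]
    exact key z (Or.inl hz) _ (hq₀ z hz)
  · have h5 : f z + (g z - f z) * smoothstep^[n] (q z) - g z
        = -((g z - f z) * smoothstep^[n] (1 - q z)) := by
      rw [← one_sub_smoothstep_iterate]; ring
    rw [h5, norm_neg]
    exact key z (Or.inr hz) _ (by rw [norm_sub_rev]; exact hq₁ z hz)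

/-! ### The escape route, and prescribing values near it -/

/-- The moduli of the points of the escape route. -/
def siteRadius : ℕ → ℝ
  | 0 => 0
  | n + 1 => 1000 * 10000 ^ n

/-- The points of the escape route. -/
def site (n : ℕ) : ℂ := (siteRadius n : ℂ)

/-- The points from which the wandering domain is sent back to a neighbourhood of `0`. -/
def port (n : ℕ) : ℂ := site n + 32

theorem siteRadius_nonneg (n : ℕ) : 0 ≤ siteRadius n := by
  cases n <;> simp [siteRadius]

theorem norm_site (n : ℕ) : ‖site n‖ = siteRadius n := by
  simp [site, abs_of_nonneg (siteRadius_nonneg n)]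

theorem siteRadius_succ_succ (n : ℕ) : siteRadius (n + 2) = 10000 * siteRadius (n + 1) := by
  simp only [siteRadius]; ring

theorem siteRadius_succ_ge (n : ℕ) : 1000 ≤ siteRadius (n + 1) := by
  have : (1 : ℝ) ≤ 10000 ^ n := one_le_pow₀ (by norm_num)
  simp only [siteRadius]; linarith

theorem siteRadius_ge {n : ℕ} (hn : n ≠ 0) : 1000 ≤ siteRadius n := by
  obtain ⟨k, rfl⟩ := Nat.exists_eq_succ_of_ne_zero hn
  exact siteRadius_succ_ge k

theorem siteRadius_add_le (n : ℕ) : siteRadius n + 1000 ≤ siteRadius (n + 1) := by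
  cases n with
  | zero => simp [siteRadius]
  | succ n =>
    have := siteRadius_succ_ge n
    rw [siteRadius_succ_succ]; linarith

theorem siteRadius_strictMono : StrictMono siteRadius :=
  strictMono_nat_of_lt_succ fun n => by have := siteRadius_add_le n; linarith

theorem siteRadius_add_le_of_lt {m n : ℕ} (h : m < n) : siteRadius m + 1000 ≤ siteRadius n :=
  (siteRadius_add_le m).trans (siteRadius_strictMono.monotone h)

theorem norm_site_next (n : ℕ) : ‖10000 * site n - site (n + 1)‖ ≤ 1000 := by
  cases n with
  | zero => simp [site, siteRadius]
  | succ n => simp [site, siteRadius_succ_succ]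

/-- Prescribe an entire function near `site i` while changing it little on a large disc. -/
theorem exists_entire_site {f g : ℂ → ℂ} (hf : Differentiable ℂ f) (hg : Differentiable ℂ g)
    {i : ℕ} (hi : i ≠ 0) {ε : ℝ} (hε : 0 < ε) :
    ∃ F : ℂ → ℂ, Differentiable ℂ F ∧
      (∀ z ∈ Metric.closedBall 0 (siteRadius i / 8), ‖F z - f z‖ ≤ ε) ∧
      ∀ z ∈ Metric.closedBall (site i) 34, ‖F z - g z‖ ≤ ε := by
  have h1 := siteRadius_ge hi
  have h0 : site i ≠ 0 := by rw [← norm_pos_iff, norm_site]; linarith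
  refine exists_entire_blend hf hg (q := fun z => z / site i) (by fun_prop)
    (isCompact_closedBall _ _) (isCompact_closedBall _ _) (fun z hz => ?_) (fun z hz => ?_) hε
  · rw [mem_closedBall_zero_iff] at hz
    rw [norm_div, norm_site, div_le_iff₀ (by linarith)]; linarith
  · rw [mem_closedBall_iff_norm] at hz
    rw [show z / site i - 1 = (z - site i) / site i by field_simp, norm_div, norm_site,
      div_le_iff₀ (by linarith)]
    linarith

/-- Prescribe an entire function near `port i` while changing it little on a large disc and near
`site i`. -/
theorem exists_entire_port {f g : ℂ → ℂ} (hf : Differentiable ℂ f) (hg : Differentiable ℂ g)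
    {i : ℕ} (hi : i ≠ 0) {ε : ℝ} (hε : 0 < ε) :
    ∃ F : ℂ → ℂ, Differentiable ℂ F ∧
      (∀ z ∈ Metric.closedBall 0 (siteRadius i / 8) ∪ Metric.closedBall (site i) 2,
        ‖F z - f z‖ ≤ ε) ∧
      ∀ z ∈ Metric.closedBall (port i) 2, ‖F z - g z‖ ≤ ε := by
  -- A multiple of `z` cannot separate `site i` from `port i`, which is only 32 away. So the
  -- blending function is itself obtained by blending: `0` on the large disc, and near `site i` the
  -- affine map taking `site i` to `0` and `port i` to `1`. The errors are `1 / 16` from the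
  -- approximation and `2 / 32` from the radius, in total `1 / 8`.
  obtain ⟨q, hq, hq₀, hq₁⟩ := exists_entire_site (f := fun _ => 0)
    (g := fun z => (z - site i) / 32) (by fun_prop) (by fun_prop) hi
    (show (0 : ℝ) < 1 / 16 by norm_num)
  refine exists_entire_blend hf hg hq
    ((isCompact_closedBall _ _).union (isCompact_closedBall _ _)) (isCompact_closedBall _ _)
    (fun z hz => ?_) (fun z hz => ?_) hε
  · rcases hz with hz | hz
    · have := hq₀ z hz
      rw [sub_zero] at this
      linarith
    · have h2 := hq₁ z (Metric.closedBall_subset_closedBall (by norm_num) hz)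
      rw [mem_closedBall_iff_norm] at hz
      have h3 : ‖(z - site i) / 32‖ ≤ 1 / 16 := by
        rw [norm_div]; norm_num; linarith
      have h4 := norm_add_le (q z - (z - site i) / 32) ((z - site i) / 32)
      rw [sub_add_cancel] at h4
      linarith
  · rw [mem_closedBall_iff_norm, port] at hz
    have h5 := norm_add_le (z - (site i + 32)) 32
    have h2 := hq₁ z (by
      rw [mem_closedBall_iff_norm]
      rw [show z - (site i + 32) + 32 = z - site i by ring] at h5
      norm_num at h5; linarith)
    have h3 : ‖(z - (site i + 32)) / 32‖ ≤ 1 / 16 := by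
      rw [norm_div]; norm_num; linarith
    have h4 := norm_add_le (q z - (z - site i) / 32) ((z - (site i + 32)) / 32)
    rw [show q z - (z - site i) / 32 + (z - (site i + 32)) / 32 = q z - 1 by ring] at h4
    linarith

/-! ### Expanding maps, open maps and perturbation of orbits -/

-- A quantitative open mapping theorem: on the unit circle about `c` the values stay at distance at
-- least 9000 from `f c`, so the image covers the disc of radius 4500 about `f c`.
open Metric in
theorem exists_preimage_of_expanding {f : ℂ → ℂ} (hf : Differentiable ℂ f) {c y : ℂ}
    (h : ∀ z ∈ closedBall c 1, ‖f z - 10000 * z‖ ≤ 1 / 2) (hy : ‖y - 10000 * c‖ ≤ 4000) :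
    ∃ x ∈ closedBall c 1, f x = y := by
  have hc := h c (mem_closedBall_self (by norm_num))
  have key : ∀ z ∈ sphere c 1, (9000 : ℝ) ≤ ‖f z - f c‖ := by
    intro z hz
    have hz1 := h z (sphere_subset_closedBall hz)
    rw [mem_sphere_iff_norm] at hz
    have e : 10000 * (z - c) = (f z - f c) - ((f z - 10000 * z) - (f c - 10000 * c)) := by ring
    have h1 : ‖10000 * (z - c)‖ = 10000 := by rw [norm_mul, hz]; norm_num
    have h2 := norm_sub_le (f z - f c) ((f z - 10000 * z) - (f c - 10000 * c))
    have h3 := norm_sub_le (f z - 10000 * z) (f c - 10000 * c)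
    rw [← e, h1] at h2
    linarith
  have hne : ∃ᶠ z in 𝓝 c, f z ≠ f c := by
    rw [Filter.Frequently]
    intro hcon
    have hev : f =ᶠ[𝓝 c] fun _ => f c := by
      filter_upwards [hcon] with z hz
      simpa using hz
    have heq := (hf.differentiableOn.analyticOnNhd isOpen_univ).eqOn_of_preconnected_of_eventuallyEq
      analyticOnNhd_const isPreconnected_univ (Set.mem_univ c) hev
    have h1 := key (c + 1) (by simp)
    rw [heq (Set.mem_univ (c + 1))] at h1
    norm_num at h1
  have hd : DiffContOnCl ℂ f (ball c 1) := hf.diffContOnCl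
  have hsub := hd.ball_subset_image_closedBall one_pos key hne
  have hmem : y ∈ ball (f c) (9000 / 2) := by
    rw [mem_ball_iff_norm]
    have := norm_sub_le (y - 10000 * c) (f c - 10000 * c)
    rw [sub_sub_sub_cancel_right] at this
    linarith
  obtain ⟨x, hx, hxy⟩ := hsub hmem
  exact ⟨x, hx, hxy⟩

-- The orbit is found backwards: the endpoint is pulled back one disc at a time, the image of each
-- disc covering the next one.
open Metric in
theorem exists_orbit_of_expanding {f : ℂ → ℂ} (hf : Differentiable ℂ f) {p : ℕ → ℂ} {n : ℕ}
    (h : ∀ j < n, ∀ z ∈ closedBall (p j) 1, ‖f z - 10000 * z‖ ≤ 1 / 2)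
    (hp : ∀ j < n, ‖10000 * p j - p (j + 1)‖ ≤ 3000) {y : ℂ} (hy : y ∈ closedBall (p n) 1) :
    ∃ c : ℂ, (∀ j ≤ n, f^[j] c ∈ closedBall (p j) 1) ∧ f^[n] c = y := by
  induction n generalizing y with
  | zero => exact ⟨y, fun j hj => by rw [Nat.le_zero.1 hj]; simpa using hy, rfl⟩
  | succ n ih =>
    obtain ⟨x, hx, hxy⟩ := exists_preimage_of_expanding hf (h n n.lt_succ_self) (y := y) (by
      rw [mem_closedBall_iff_norm] at hy
      have h1 := hp n n.lt_succ_self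
      have h2 := norm_sub_le (y - p (n + 1)) (10000 * p n - p (n + 1))
      rw [sub_sub_sub_cancel_right] at h2
      linarith)
    obtain ⟨c, hc, hcn⟩ := ih (fun j hj => h j (hj.trans n.lt_succ_self))
      (fun j hj => hp j (hj.trans n.lt_succ_self)) hx
    have hlast : f^[n + 1] c = y := by rw [Function.iterate_succ_apply', hcn, hxy]
    refine ⟨c, fun j hj => ?_, hlast⟩
    rcases Nat.le_succ_iff.1 hj with hj | rfl
    · exact hc j hj
    · rw [hlast]; exact hy

theorem isOpenMap_of_expanding {f : ℂ → ℂ} (hf : Differentiable ℂ f)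
    (h : ∀ z ∈ Metric.closedBall (0 : ℂ) 1, ‖f z - 10000 * z‖ ≤ 1 / 2) : IsOpenMap f := by
  rcases (hf.differentiableOn.analyticOnNhd isOpen_univ).is_constant_or_isOpenMap with ⟨w, hw⟩ | H
  · obtain ⟨x, -, hx⟩ := exists_preimage_of_expanding hf h (y := 0) (by simp)
    obtain ⟨x', -, hx'⟩ := exists_preimage_of_expanding hf h (y := 1) (by norm_num)
    rw [hw] at hx hx'
    exact absurd (hx.symm.trans hx') (by norm_num)
  · exact H

theorem IsOpenMap.eventually_ne_of_differentiable {f : ℂ → ℂ} (ho : IsOpenMap f)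
    (hf : Differentiable ℂ f) (c : ℂ) : ∀ᶠ z in 𝓝[≠] c, f z ≠ f c := by
  rcases (hf.analyticAt c).eventually_eq_or_eventually_ne (analyticAt_const (v := f c)) with H | H
  · exfalso
    have h1 : f '' {z | f z = f c} ∈ 𝓝 (f c) := ho.image_mem_nhds H
    have h2 : f '' {z | f z = f c} ⊆ {f c} := by
      rintro _ ⟨z, hz, rfl⟩
      exact hz
    have h3 := Filter.mem_of_superset h1 h2
    exact (not_isOpen_singleton (f c)) (isOpen_singleton_iff_nhds_eq_pure _ |>.2
      (le_antisymm (by simpa using h3) (pure_le_nhds _)))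
  · exact H

/-- An open map is uniformly open on compact sets. -/
theorem IsOpenMap.exists_uniform_of_isCompact {F : ℂ → ℂ} (ho : IsOpenMap F) (hF : Continuous F)
    {K : Set ℂ} (hK : IsCompact K) {ε : ℝ} (hε : 0 < ε) :
    ∃ δ > 0, ∀ w ∈ K, ∀ y, ‖y - F w‖ < δ → ∃ w', ‖w' - w‖ < ε ∧ F w' = y := by
  refine hK.induction_on
    (p := fun S => ∃ δ > 0, ∀ w ∈ S, ∀ y, ‖y - F w‖ < δ → ∃ w', ‖w' - w‖ < ε ∧ F w' = y)
    ⟨1, one_pos, by simp⟩ ?_ ?_ ?_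
  · rintro S T hST ⟨δ, hδ, H⟩
    exact ⟨δ, hδ, fun w hw => H w (hST hw)⟩
  · rintro S T ⟨δ, hδ, H⟩ ⟨δ', hδ', H'⟩
    refine ⟨min δ δ', lt_min hδ hδ', fun w hw y hy => ?_⟩
    rcases hw with hw | hw
    · exact H w hw y (hy.trans_le (min_le_left _ _))
    · exact H' w hw y (hy.trans_le (min_le_right _ _))
  · intro x _
    obtain ⟨δ, hδ, hball⟩ := Metric.mem_nhds_iff.1
      (ho.image_mem_nhds (Metric.ball_mem_nhds x (half_pos hε)))
    have h1 : ∀ᶠ w in 𝓝 x, ‖w - x‖ < ε / 2 := by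
      filter_upwards [Metric.ball_mem_nhds x (half_pos hε)] with w hw
      exact mem_ball_iff_norm.1 hw
    have h2 : ∀ᶠ w in 𝓝 x, ‖F w - F x‖ < δ / 2 := by
      filter_upwards [hF.continuousAt.preimage_mem_nhds (Metric.ball_mem_nhds (F x) (half_pos hδ))]
        with w hw
      exact mem_ball_iff_norm.1 hw
    refine ⟨_, mem_nhdsWithin_of_mem_nhds (h1.and h2), δ / 2, half_pos hδ, ?_⟩
    rintro w ⟨hw1, hw2⟩ y hy
    have hy' : y ∈ Metric.ball (F x) δ := by
      rw [mem_ball_iff_norm]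
      have := norm_add_le (y - F w) (F w - F x)
      rw [sub_add_sub_cancel] at this
      linarith
    obtain ⟨w', hw', rfl⟩ := hball hy'
    refine ⟨w', ?_, rfl⟩
    rw [mem_ball_iff_norm] at hw'
    have := norm_sub_le (w' - x) (w - x)
    rw [sub_sub_sub_cancel_right] at this
    linarith

/-- Finite orbits depend continuously on the map and on the starting point. -/
theorem exists_iterate_close {f : ℂ → ℂ} (hf : Continuous f) {W W₀ : Set ℂ}
    (hW : IsCompact W) {θ : ℝ} (hθ : 0 < θ) (hθW : ∀ x ∈ W₀, ∀ y, ‖y - x‖ ≤ θ → y ∈ W)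
    (n : ℕ) {ε : ℝ} (hε : 0 < ε) :
    ∃ δ > 0, ∀ h : ℂ → ℂ, (∀ z ∈ W, ‖h z - f z‖ ≤ δ) → ∀ x x' : ℂ, ‖x' - x‖ ≤ δ →
      (∀ j < n, f^[j] x ∈ W₀ ∨ h^[j] x' ∈ W₀) → ∀ j ≤ n, ‖h^[j] x' - f^[j] x‖ ≤ ε := by
  induction n generalizing ε with
  | zero =>
    refine ⟨ε, hε, fun h _ x x' hx _ j hj => ?_⟩
    rw [Nat.le_zero.1 hj]
    simpa using hx
  | succ n ih =>
    have huc := hW.uniformContinuousOn_of_continuous hf.continuousOn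
    rw [Metric.uniformContinuousOn_iff] at huc
    obtain ⟨δ₁, hδ₁, hu⟩ := huc (ε / 2) (half_pos hε)
    obtain ⟨δ₂, hδ₂, H⟩ := ih (ε := min (min ε θ) (δ₁ / 2))
      (lt_min (lt_min hε hθ) (half_pos hδ₁))
    refine ⟨min δ₂ (ε / 2), lt_min hδ₂ (half_pos hε), fun h hh x x' hx horb => ?_⟩
    have H' := H h (fun z hz => (hh z hz).trans (min_le_left _ _)) x x'
      (hx.trans (min_le_left _ _)) (fun j hj => horb j (hj.trans n.lt_succ_self))
    intro j hj
    rcases Nat.le_succ_iff.1 hj with hj | rfl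
    · exact (H' j hj).trans ((min_le_left _ _).trans (min_le_left _ _))
    · have hn := H' n le_rfl
      have hnθ := hn.trans ((min_le_left _ _).trans (min_le_right _ _))
      have hnδ := hn.trans (min_le_right _ _)
      -- Only one of the two orbits is known to be in `W₀`; the other is within `θ` of it, hence
      -- still in `W`.
      have hmem : f^[n] x ∈ W ∧ h^[n] x' ∈ W := by
        rcases horb n n.lt_succ_self with h1 | h1
        · exact ⟨hθW _ h1 _ (by simpa using hθ.le), hθW _ h1 _ hnθ⟩
        · exact ⟨hθW _ h1 _ (by rwa [norm_sub_rev]), hθW _ h1 _ (by simpa using hθ.le)⟩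
      have e1 := (hh _ hmem.2).trans (min_le_right _ _)
      have e2 := hu _ hmem.2 _ hmem.1 (by rw [dist_eq_norm]; linarith)
      rw [dist_eq_norm] at e2
      rw [Function.iterate_succ_apply', Function.iterate_succ_apply']
      have := norm_add_le (h (h^[n] x') - f (h^[n] x')) (f (h^[n] x') - f (f^[n] x))
      rw [sub_add_sub_cancel] at this
      linarith

/-! ### Power maps with a thin collar -/

/-- Roots of high order of a fixed number are dense near the unit circle. -/
theorem exists_root_near_circle {Y : ℂ} (hY : Y ≠ 0) {δ : ℝ} (hδ : 0 < δ) :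
    ∃ η : ℝ, 0 < η ∧ η ≤ 1 / 2 ∧ ∀ᶠ d : ℕ in atTop, ∀ x : ℂ, 1 - η ≤ ‖x‖ → ‖x‖ ≤ 1 →
      ∃ x' : ℂ, ‖x' - x‖ ≤ δ ∧ x' ^ d = Y := by
  set δ' := min δ 1 with hδ'
  have hδ'0 : 0 < δ' := lt_min hδ one_pos
  have hδ'1 : δ' ≤ 1 := min_le_right _ _
  refine ⟨δ' / 8, by positivity, by linarith, ?_⟩
  have hlim : Tendsto (fun d : ℕ => (|Real.log ‖Y‖| + Real.pi) / (d : ℝ)) atTop (𝓝 0) :=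
    tendsto_const_div_atTop_nhds_zero_nat _
  filter_upwards [hlim.eventually (gt_mem_nhds (show 0 < δ' / 4 by positivity)),
    eventually_gt_atTop 0] with d hd hd0 x hx hx1
  have hxpos : 0 < ‖x‖ := by linarith
  have hx0 : x ≠ 0 := norm_pos_iff.1 hxpos
  have hdR : (0 : ℝ) < d := by exact_mod_cast hd0
  have hdC : (d : ℂ) ≠ 0 := by exact_mod_cast hd0.ne'
  have hq : Y / x ^ d ≠ 0 := div_ne_zero hY (pow_ne_zero _ hx0)
  set L := Complex.log (Y / x ^ d) with hL
  have hre : L.re = Real.log ‖Y‖ - d * Real.log ‖x‖ := by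
    rw [hL, Complex.log_re, norm_div, norm_pow, Real.log_div (norm_ne_zero_iff.2 hY) (by positivity),
      Real.log_pow]
  have him : |L.im| ≤ Real.pi := by rw [hL, Complex.log_im]; exact Complex.abs_arg_le_pi _
  have hlogx : |Real.log ‖x‖| ≤ δ' / 4 := by
    rw [abs_of_nonpos (Real.log_nonpos hxpos.le hx1)]
    have h1 := Real.one_sub_inv_le_log_of_pos hxpos
    have h2 : ‖x‖⁻¹ ≤ 1 + δ' / 4 := by
      rw [inv_le_comm₀ hxpos (by linarith)]
      refine le_trans ?_ hx
      rw [inv_le_iff_one_le_mul₀ (by linarith)]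
      nlinarith
    linarith
  have hLn : ‖L / d‖ ≤ δ' / 2 := by
    rw [norm_div, Complex.norm_natCast, div_le_iff₀ hdR]
    have h1 := Complex.norm_le_abs_re_add_abs_im L
    have h2 : |L.re| ≤ |Real.log ‖Y‖| + d * (δ' / 4) := by
      rw [hre]
      refine (abs_sub _ _).trans ?_
      rw [abs_mul, abs_of_pos hdR]
      have := mul_le_mul_of_nonneg_left hlogx hdR.le
      linarith
    rw [div_lt_iff₀ hdR] at hd
    linarith
  -- Multiplying by a `d`-th root of `Y / x ^ d` corrects the power exactly. The factor is near 1,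
  -- since the imaginary part of `L` is at most `π` and its real part grows with `d` only at the
  -- small rate `|log ‖x‖|`.
  refine ⟨x * Complex.exp (L / d), ?_, ?_⟩
  · rw [show x * Complex.exp (L / d) - x = x * (Complex.exp (L / d) - 1) by ring, norm_mul]
    have h1 := Complex.norm_exp_sub_one_le (x := L / d) (by linarith)
    have h2 := mul_le_mul hx1 h1 (norm_nonneg _) zero_le_one
    have h3 : δ' ≤ δ := min_le_left _ _
    linarith
  · rw [mul_pow, ← Complex.exp_nat_mul, mul_div_cancel₀ _ hdC, hL, Complex.exp_log hq,
      mul_div_cancel₀ _ (pow_ne_zero _ hx0)]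

/-- A disc can be mapped by a power map onto a small disc such that all but a thin collar goes
close to the centre, and the collar is close to preimages of a prescribed point. -/
theorem exists_power_map {a b c : ℂ} (hbc : b ≠ c) {r σ δ δ₀ : ℝ} (hr : 0 < r) (hσ : 0 < σ)
    (hδ : 0 < δ) (hδ₀ : 0 < δ₀) :
    ∃ (g : ℂ → ℂ) (t : ℝ), Differentiable ℂ g ∧ t < r ∧ r / 2 ≤ t ∧
      (∀ y, ‖y - a‖ ≤ r → ‖g y - c‖ ≤ σ) ∧ (∀ y, ‖y - a‖ = r → ‖g y - c‖ = σ) ∧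
      (∀ y, ‖y - a‖ ≤ t → ‖g y - c‖ ≤ δ₀) ∧
      ∀ y, t ≤ ‖y - a‖ → ‖y - a‖ ≤ r → ∃ y', ‖y' - y‖ ≤ δ ∧ g y' = b := by
  have hσC : (σ : ℂ) ≠ 0 := by exact_mod_cast hσ.ne'
  have hrC : (r : ℂ) ≠ 0 := by exact_mod_cast hr.ne'
  obtain ⟨η, hη, hη2, hev⟩ := exists_root_near_circle (Y := (b - c) / σ)
    (div_ne_zero (sub_ne_zero.2 hbc) hσC) (div_pos hδ hr)
  have hlim : Tendsto (fun d : ℕ => σ * (1 - η) ^ d) atTop (𝓝 (σ * 0)) :=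
    (tendsto_pow_atTop_nhds_zero_of_lt_one (by linarith) (by linarith)).const_mul σ
  rw [mul_zero] at hlim
  obtain ⟨d, hd, hd'⟩ := (hev.and (hlim.eventually (gt_mem_nhds hδ₀))).exists
  have hnorm : ∀ y : ℂ, ‖c + σ * ((y - a) / r) ^ d - c‖ = σ * (‖y - a‖ / r) ^ d := by
    intro y
    rw [add_sub_cancel_left, norm_mul, norm_pow, norm_div, Complex.norm_real, Complex.norm_real,
      Real.norm_of_nonneg hσ.le, Real.norm_of_nonneg hr.le]
  refine ⟨fun y => c + σ * ((y - a) / r) ^ d, r * (1 - η), by fun_prop, by nlinarith, by nlinarith,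
    fun y hy => ?_, fun y hy => ?_, fun y hy => ?_, fun y hy hy' => ?_⟩
  · rw [hnorm]
    have : (‖y - a‖ / r) ^ d ≤ 1 := pow_le_one₀ (by positivity) (by rwa [div_le_one hr])
    nlinarith
  · rw [hnorm, hy, div_self hr.ne', one_pow, mul_one]
  · rw [hnorm]
    have : (‖y - a‖ / r) ^ d ≤ (1 - η) ^ d :=
      pow_le_pow_left₀ (by positivity) (by rw [div_le_iff₀ hr]; linarith) d
    have := mul_le_mul_of_nonneg_left this hσ.le
    linarith
  · have hn : ‖(y - a) / (r : ℂ)‖ = ‖y - a‖ / r := by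
      rw [norm_div, Complex.norm_real, Real.norm_of_nonneg hr.le]
    obtain ⟨x', hx', hroot⟩ := hd ((y - a) / r)
      (by rw [hn, le_div_iff₀ hr]; linarith) (by rw [hn, div_le_one hr]; exact hy')
    refine ⟨a + r * x', ?_, ?_⟩
    · have e : a + r * x' - y = r * (x' - (y - a) / r) := by field_simp; ring
      rw [e, norm_mul, Complex.norm_real, Real.norm_of_nonneg hr.le]
      rw [le_div_iff₀ hr] at hx'
      linarith
    · simp only [add_sub_cancel_left, mul_div_cancel_left₀ _ hrC, hroot,
        mul_div_cancel₀ _ hσC]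
      ring

/-! ### One more excursion: the inductive step -/

theorem siteRadius_add_le_div {j i : ℕ} (hi : 2 ≤ i) (hj : j < i) :
    siteRadius j + 500 ≤ siteRadius i / 16 := by
  obtain ⟨k, rfl⟩ := Nat.exists_eq_add_of_le' hi
  have h1 : siteRadius j ≤ siteRadius (k + 1) := siteRadius_strictMono.monotone (by omega)
  have h2 := siteRadius_succ_ge k
  rw [siteRadius_succ_succ]; linarith

theorem closedBall_site_subset {j i : ℕ} (hi : 2 ≤ i) (hj : j < i) {s : ℝ} (hs : s ≤ 400) :
    Metric.closedBall (site j) s ⊆ Metric.closedBall 0 (siteRadius i / 16) := by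
  refine Metric.closedBall_subset_closedBall' ?_
  rw [dist_zero_right, norm_site]
  linarith [siteRadius_add_le_div hi hj]

theorem closedBall_port_subset {j i : ℕ} (hi : 2 ≤ i) (hj : j < i) {s : ℝ} (hs : s ≤ 300) :
    Metric.closedBall (port j) s ⊆ Metric.closedBall 0 (siteRadius i / 16) := by
  refine (Metric.closedBall_subset_closedBall' (ε₂ := s + 32) ?_).trans
    (closedBall_site_subset hi hj (by linarith))
  rw [dist_eq_norm, port, add_sub_cancel_left]
  norm_num

theorem closedBall_sixteenth_subset (i : ℕ) :
    Metric.closedBall (0 : ℂ) (siteRadius i / 16) ⊆ Metric.closedBall 0 (siteRadius i / 8) :=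
  Metric.closedBall_subset_closedBall (by linarith [siteRadius_nonneg i])

theorem IsOpenMap.iterate_map {F : ℂ → ℂ} (h : IsOpenMap F) (n : ℕ) : IsOpenMap F^[n] := by
  induction n with
  | zero => exact IsOpenMap.id
  | succ n ih => exact ih.comp h

/-- `h` is close to `z ↦ 10000 z` near the first `i` sites and close to a constant near `port 1`,
which makes `port 1` the centre of a trapping disc. -/
def NearModel (i : ℕ) (h : ℂ → ℂ) : Prop :=
  (∀ j < i, ∀ z ∈ Metric.closedBall (site j) 2, ‖h z - 10000 * z‖ ≤ 1 / 2) ∧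
    ∀ z ∈ Metric.closedBall (port 1) 2, ‖h z - port 1‖ ≤ 1 / 2

/-- All maps that are `κ`-close to the entire function `f` on a large disc are near the model. -/
structure IsStage (i : ℕ) (f : ℂ → ℂ) (κ : ℝ) : Prop where
  differentiable : Differentiable ℂ f
  pos : 0 < κ
  le_one : κ ≤ 1
  nearModel : ∀ h : ℂ → ℂ, (∀ z ∈ Metric.closedBall 0 (siteRadius i / 8), ‖h z - f z‖ ≤ κ) →
    NearModel i h

/-- The map `h` transports the disc of radius `r` about `port i` to the disc of radius `r'` about
`port (i + 1)` in time `m + i + 1`, of which `m` steps are spent near `0`. The points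
which leave the disc of radius `r` about `port i` are close to trapped points. -/
structure Transit (i m τ : ℕ) (r r' : ℝ) (h : ℂ → ℂ) : Prop where
  itinerary : ∀ j, 1 ≤ j → j ≤ m + i → ∃ p ∈ Metric.closedBall (site (j - m)) 1,
    ∀ y ∈ Metric.closedBall (port i) r, ‖h^[j] y - p‖ ≤ 1 / i
  boundary : ∀ y, ‖y - port i‖ = r → r' < ‖h^[m + i + 1] y - port (i + 1)‖
  core : ∀ y, ‖y - port i‖ ≤ r / 2 → ‖h^[m + i + 1] y - port (i + 1)‖ ≤ r' / 2
  collar : ∀ w ∈ Metric.closedBall (port 2) 1,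
    (∀ j < τ, h^[j] w ∈ Metric.closedBall 0 (siteRadius i / 16)) →
    h^[τ] w ∈ Metric.closedBall (port i) r →
    h^[τ + (m + i + 1)] w ∉ Metric.closedBall (port (i + 1)) r' →
    ∃ w', ‖w' - w‖ ≤ 1 / i ∧ h^[τ + 1] w' ∈ Metric.closedBall (port 1) 1

-- All assertions concern finitely many iterates, and the margins in the hypotheses (`2 * r'` on the
-- circle, `r' / 4` in the core) absorb a small perturbation of `F` and `g`. For the collar, uniform
-- openness of `F^[τ]` yields a start near `w` that reaches a prescribed point of `g ⁻¹' {port 1}`.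
open Metric in
theorem exists_transit_of_close {F g : ℂ → ℂ} (hF : Continuous F) (hg : Continuous g)
    {i m τ : ℕ} (hi : 2 ≤ i) {r r' σ δ δ₀ ρ t : ℝ} {c : ℂ} (hr1 : r ≤ 1) (hr' : 0 < r')
    (hδ : 0 < δ) (hδ2 : δ ≤ 1 / 2) (hρ : ρ ≤ 1 / i) (ht : r / 2 ≤ t)
    (horb : ∀ j < m + i, F^[j] c ∈ closedBall (site (j + 1 - m)) 1)
    (hsmall : ∀ x, ‖x - c‖ ≤ σ → ∀ j < m + i, ‖F^[j] x - F^[j] c‖ ≤ 1 / (2 * i))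
    (hsphere : ∀ x, ‖x - c‖ = σ → 2 * r' ≤ ‖F^[m + i] x - port (i + 1)‖)
    (hcore : ∀ x, ‖x - c‖ ≤ δ₀ → ‖F^[m + i] x - port (i + 1)‖ ≤ r' / 4)
    (hg₁ : ∀ y, ‖y - port i‖ ≤ r → ‖g y - c‖ ≤ σ)
    (hg₂ : ∀ y, ‖y - port i‖ = r → ‖g y - c‖ = σ)
    (hg₃ : ∀ y, ‖y - port i‖ ≤ t → ‖g y - c‖ ≤ δ₀)
    (hg₄ : ∀ y, t ≤ ‖y - port i‖ → ‖y - port i‖ ≤ r → ∃ y', ‖y' - y‖ ≤ δ ∧ g y' = port 1)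
    (hopen : ∀ w ∈ closedBall (port 2) 1, ∀ y, ‖y - F^[τ] w‖ < 2 * δ →
      ∃ w', ‖w' - w‖ < ρ ∧ F^[τ] w' = y)
    (hcont : ∀ w ∈ closedBall (port 2) 1, ∀ w', ‖w' - w‖ < ρ → ∀ j < τ,
      ‖F^[j] w' - F^[j] w‖ ≤ 1) :
    ∃ ε > 0, ∀ h : ℂ → ℂ,
      (∀ z ∈ closedBall 0 (siteRadius i / 8) ∪ closedBall (site i) 2, ‖h z - F z‖ ≤ ε) →
      (∀ z ∈ closedBall (port i) 2, ‖h z - g z‖ ≤ ε) → Transit i m τ r r' h := by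
  have hiR : (2 : ℝ) ≤ i := by exact_mod_cast hi
  have hinv : 1 / (2 * (i : ℝ)) ≤ 1 / 2 := by
    rw [div_le_div_iff₀ (by positivity) (by norm_num)]; linarith
  have hrad : 1000 ≤ siteRadius i := siteRadius_ge (by omega)
  have hinv0 : 0 < 1 / (2 * (i : ℝ)) := by positivity
  have hcompact : IsCompact (closedBall (0 : ℂ) (siteRadius i / 8) ∪ closedBall (site i) 2) :=
    (isCompact_closedBall _ _).union (isCompact_closedBall _ _)
  have hthick : ∀ x ∈ closedBall (0 : ℂ) (siteRadius i / 8 - 1) ∪ closedBall (site i) (3 / 2),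
      ∀ y, ‖y - x‖ ≤ 1 / 2 → y ∈ closedBall 0 (siteRadius i / 8) ∪ closedBall (site i) 2 := by
    intro x hx y hy
    rw [← dist_eq_norm] at hy
    rcases hx with hx | hx
    · left
      rw [mem_closedBall] at hx ⊢
      linarith [dist_triangle y x 0]
    · right
      rw [mem_closedBall] at hx ⊢
      linarith [dist_triangle y x (site i)]
  obtain ⟨ε₁, hε₁, H₁⟩ := exists_iterate_close hF hcompact (by norm_num) hthick (m + i)
    (ε := min (1 / (2 * (i : ℝ))) (r' / 4)) (lt_min hinv0 (by linarith))
  have huc := (isCompact_closedBall (port i) 2).uniformContinuousOn_of_continuous hg.continuousOn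
  rw [Metric.uniformContinuousOn_iff] at huc
  obtain ⟨δ₁, hδ₁, hu⟩ := huc (1 / 4) (by norm_num)
  set ε₃ := min (δ / 2) (δ₁ / 2) with hε₃
  have hε₃0 : 0 < ε₃ := lt_min (by linarith) (by linarith)
  have hε₃δ : ε₃ ≤ δ / 2 := min_le_left _ _
  have hε₃δ₁ : ε₃ ≤ δ₁ / 2 := min_le_right _ _
  obtain ⟨ε₂, hε₂, H₂⟩ := exists_iterate_close hF hcompact (by norm_num) hthick τ (ε := ε₃) hε₃0
  refine ⟨min (min ε₁ ε₂) (1 / 4), by positivity, fun h hhF hhg => ?_⟩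
  have hhF₁ := fun z hz => (hhF z hz).trans ((min_le_left _ _).trans (min_le_left _ _))
  have hhF₂ := fun z hz => (hhF z hz).trans ((min_le_left _ _).trans (min_le_right _ _))
  have hhg₁ := fun z hz => (hhg z hz).trans ((min_le_left _ _).trans (min_le_left _ _))
  have hhg₃ := fun z hz => (hhg z hz).trans (min_le_right _ _)
  have hpasses : ∀ x, ‖x - c‖ ≤ σ → ∀ j < m + i,
      F^[j] x ∈ closedBall (0 : ℂ) (siteRadius i / 8 - 1) ∪ closedBall (site i) (3 / 2) := by
    intro x hx j hj
    have h1 := horb j hj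
    have h2 := hsmall x hx j hj
    have h3 : F^[j] x ∈ closedBall (site (j + 1 - m)) (3 / 2) := by
      rw [mem_closedBall] at h1 ⊢
      rw [← dist_eq_norm] at h2
      linarith [dist_triangle (F^[j] x) (F^[j] c) (site (j + 1 - m))]
    rcases (show j + 1 - m ≤ i by omega).lt_or_eq with h4 | h4
    · left
      have h5 := closedBall_site_subset hi h4 (by norm_num) h3
      rw [mem_closedBall] at h5 ⊢
      linarith
    · right
      rwa [h4] at h3
  have hclose : ∀ y, ‖y - port i‖ ≤ r → ∀ j ≤ m + i,
      ‖h^[j + 1] y - F^[j] (g y)‖ ≤ min (1 / (2 * (i : ℝ))) (r' / 4) := by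
    intro y hy j hj
    rw [Function.iterate_succ_apply]
    refine H₁ h hhF₁ (g y) (h y) (hhg₁ y ?_) (fun j hj => Or.inl (hpasses _ (hg₁ y hy) j hj)) j hj
    rw [mem_closedBall_iff_norm]; linarith
  refine ⟨fun j hj1 hj => ?_, fun y hy => ?_, fun y hy => ?_, fun w hw hworb hwτ hwout => ?_⟩
  · obtain ⟨j, rfl⟩ := Nat.exists_eq_add_of_le' hj1
    refine ⟨F^[j] c, horb j (by omega), fun y hy => ?_⟩
    rw [mem_closedBall_iff_norm] at hy
    have h1 := (hclose y hy j (by omega)).trans (min_le_left _ _)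
    have h2 := hsmall (g y) (hg₁ y hy) j (by omega)
    have h3 := norm_add_le (h^[j + 1] y - F^[j] (g y)) (F^[j] (g y) - F^[j] c)
    rw [sub_add_sub_cancel] at h3
    have h4 : 1 / (i : ℝ) = 1 / (2 * i) + 1 / (2 * i) := by field_simp; norm_num
    rw [h4]; linarith
  · have h1 := (hclose y hy.le (m + i) le_rfl).trans (min_le_right _ _)
    have h2 := hsphere (g y) (hg₂ y hy)
    have h3 := norm_sub_norm_le (F^[m + i] (g y) - port (i + 1)) (h^[m + i + 1] y - port (i + 1))
    rw [sub_sub_sub_cancel_right, norm_sub_rev (F^[m + i] (g y)) (h^[m + i + 1] y)] at h3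
    linarith
  · by_cases hneg : ‖y - port i‖ ≤ r
    · have h1 := (hclose y hneg (m + i) le_rfl).trans (min_le_right _ _)
      have h2 := hcore (g y) (hg₃ y (hy.trans ht))
      have h3 := norm_add_le (h^[m + i + 1] y - F^[m + i] (g y)) (F^[m + i] (g y) - port (i + 1))
      rw [sub_add_sub_cancel] at h3
      linarith
    · exfalso
      linarith [norm_nonneg (y - port i)]
  · set y := h^[τ] w with hy
    rw [mem_closedBall_iff_norm] at hwτ
    -- A point of the inner disc would land well inside the target, so a point that misses the
    -- target lies in the collar.
    have hty : t ≤ ‖y - port i‖ := by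
      by_contra! hlt
      refine hwout ?_
      have h1 := (hclose y hwτ (m + i) le_rfl).trans (min_le_right _ _)
      have h2 := hcore (g y) (hg₃ y hlt.le)
      have h3 := norm_add_le (h^[m + i + 1] y - F^[m + i] (g y)) (F^[m + i] (g y) - port (i + 1))
      rw [sub_add_sub_cancel] at h3
      rw [add_comm τ, Function.iterate_add_apply, mem_closedBall_iff_norm]
      linarith
    obtain ⟨y', hy'y, hgy'⟩ := hg₄ y hty hwτ
    have hFw : ∀ j ≤ τ, ‖h^[j] w - F^[j] w‖ ≤ ε₃ :=
      H₂ h hhF₂ w w (by simpa using hε₂.le) fun j hj => Or.inr (Or.inl (by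
        have := hworb j hj
        rw [mem_closedBall] at this ⊢
        linarith))
    obtain ⟨w', hw'w, hFw'⟩ := hopen w hw y' (by
      have := norm_add_le (y' - y) (h^[τ] w - F^[τ] w)
      rw [← hy, sub_add_sub_cancel] at this
      have h2 := hFw τ le_rfl
      rw [← hy] at h2
      linarith)
    refine ⟨w', hw'w.le.trans hρ, ?_⟩
    have hlast : ‖h^[τ] w' - y'‖ ≤ ε₃ := by
      rw [← hFw']
      refine H₂ h hhF₂ w' w' (by simpa using hε₂.le) (fun j hj => Or.inl (Or.inl ?_)) τ le_rfl
      have h1 := hworb j hj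
      have h2 := hFw j hj.le
      have h3 := hcont w hw w' hw'w j hj
      rw [mem_closedBall_zero_iff] at h1 ⊢
      have h4 := norm_add_le (F^[j] w' - F^[j] w) (F^[j] w - h^[j] w)
      rw [sub_add_sub_cancel, norm_sub_rev (F^[j] w)] at h4
      have h5 := norm_add_le (F^[j] w' - h^[j] w) (h^[j] w)
      rw [sub_add_cancel] at h5
      linarith
    rw [Function.iterate_succ_apply', mem_closedBall_iff_norm]
    have hy'2 : ‖y' - port i‖ ≤ 3 / 2 := by
      have := norm_add_le (y' - y) (y - port i)
      rw [sub_add_sub_cancel] at this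
      linarith
    have hu2 : h^[τ] w' ∈ closedBall (port i) 2 := by
      rw [mem_closedBall_iff_norm]
      have := norm_add_le (h^[τ] w' - y') (y' - port i)
      rw [sub_add_sub_cancel] at this
      linarith
    have h1 := hhg₃ _ hu2
    have h2 := hu _ hu2 y' (by rw [mem_closedBall_iff_norm]; linarith)
      (by rw [dist_eq_norm]; linarith)
    rw [dist_eq_norm, hgy'] at h2
    have h3 := norm_add_le (h (h^[τ] w') - g (h^[τ] w')) (g (h^[τ] w') - port 1)
    rw [sub_add_sub_cancel] at h3
    linarith

open Metric in
/-- The induction step: an entire function can be modified far away so as to realise one more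
excursion of the wandering domain. -/
theorem IsStage.exists_next {i : ℕ} (hi : 2 ≤ i) {f : ℂ → ℂ} {κ : ℝ} (hf : IsStage i f κ)
    (m τ : ℕ) {r : ℝ} (hr : 0 < r) (hr1 : r ≤ 1) :
    ∃ (f' : ℂ → ℂ) (κ' r' : ℝ), IsStage (i + 1) f' κ' ∧ κ' ≤ κ / 2 ∧ 0 < r' ∧ r' ≤ 1 / i ∧
      (∀ z ∈ closedBall 0 (siteRadius i / 8), ‖f' z - f z‖ ≤ κ / 2) ∧
      ∀ h : ℂ → ℂ, (∀ z ∈ closedBall 0 (siteRadius (i + 1) / 8), ‖h z - f' z‖ ≤ κ') →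
        Transit i m τ r r' h := by
  have hiR : (2 : ℝ) ≤ i := by exact_mod_cast hi
  have hi0 : i ≠ 0 := by omega
  have hκ := hf.pos
  have hκ1 := hf.le_one
  obtain ⟨F, hF, hFf, hFs⟩ := exists_entire_site hf.differentiable
    (g := fun z => 10000 * z) (by fun_prop) hi0 (show 0 < κ / 8 by positivity)
  have hmodelF := hf.nearModel F fun z hz => (hFf z hz).trans (by linarith)
  have hexp : ∀ j ≤ i, ∀ z ∈ closedBall (site j) 1, ‖F z - 10000 * z‖ ≤ 1 / 2 := by
    intro j hj z hz
    rcases hj.lt_or_eq with hj | rfl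
    · exact hmodelF.1 j hj z (closedBall_subset_closedBall (by norm_num) hz)
    · exact (hFs z (closedBall_subset_closedBall (by norm_num) hz)).trans (by linarith)
  have hFo : IsOpenMap F := isOpenMap_of_expanding hF fun z hz => hexp 0 (Nat.zero_le _) z (by
    simpa [site, siteRadius] using hz)
  -- the landing point
  obtain ⟨c, hc, hcn⟩ := exists_orbit_of_expanding hF (n := m + i)
    (p := fun j => if j < m + i then site (j + 1 - m) else port (i + 1)) (y := port (i + 1))
    (fun j hj z hz => by
      rw [if_pos hj] at hz
      exact hexp _ (by omega) z hz)
    (fun j hj => by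
      rw [if_pos hj]
      have h0 := norm_site_next (j + 1 - m)
      split_ifs with h1
      · rcases le_or_gt m (j + 1) with h2 | h2
        · rw [show j + 1 + 1 - m = j + 1 - m + 1 by omega]
          linarith
        · rw [show j + 1 - m = 0 by omega, show j + 1 + 1 - m = 0 by omega]
          simp [site, siteRadius]
      · have h2 : j + 1 - m = i := by omega
        rw [h2] at h0 ⊢
        -- The final jump goes to a port rather than a site, which costs 32 more than the 1000
        -- allowed between sites.
        have h3 := norm_sub_le (10000 * site i - site (i + 1)) 32
        rw [sub_sub] at h3
        norm_num at h3
        rw [port]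
        linarith)
    (by simp)
  have horb : ∀ j < m + i, F^[j] c ∈ closedBall (site (j + 1 - m)) 1 := by
    intro j hj
    have := hc j hj.le
    rwa [if_pos hj] at this
  -- The power map needs a nonzero number to take roots of. The orbit starts within 1 of `site 0` or
  -- `site 1`, depending on whether `m = 0`, hence away from `port 1`.
  have hbc : port 1 ≠ c := by
    intro hcon
    have h0 := horb 0 (by omega)
    rw [Function.iterate_zero_apply, ← hcon, mem_closedBall_iff_norm] at h0
    rcases (show 0 + 1 - m = 0 ∨ 0 + 1 - m = 1 by omega) with h1 | h1 <;> rw [h1] at h0 <;>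
      norm_num [port, site, siteRadius] at h0
  -- the size of the target of the disc about `port i`
  set P := F^[m + i] with hP
  have hPd : Differentiable ℂ P := hF.iterate _
  have hPo : IsOpenMap P := hFo.iterate_map _
  have hsmall_ev : ∀ᶠ s in 𝓝[>] (0 : ℝ), (∀ x, ‖x - c‖ ≤ s → ∀ j < m + i,
      ‖F^[j] x - F^[j] c‖ ≤ 1 / (2 * i)) ∧ ∀ x, ‖x - c‖ = s → P x ≠ port (i + 1) := by
    have h1 : ∀ᶠ x in 𝓝 c, ∀ j < m + i, ‖F^[j] x - F^[j] c‖ ≤ 1 / (2 * i) := by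
      have := (Set.finite_lt_nat (m + i)).eventually_all (l := 𝓝 c)
        (p := fun j x => ‖F^[j] x - F^[j] c‖ ≤ 1 / (2 * i))
      refine this.2 fun j _ => ?_
      have hj : Continuous F^[j] := hF.continuous.iterate j
      have h3 := hj.continuousAt.preimage_mem_nhds
        (closedBall_mem_nhds (F^[j] c) (show 0 < 1 / (2 * (i : ℝ)) by positivity))
      filter_upwards [h3] with x hx
      exact mem_closedBall_iff_norm.1 hx
    have h2 := hPo.eventually_ne_of_differentiable hPd c
    rw [eventually_nhdsWithin_iff] at h2
    obtain ⟨s, hs, hball⟩ := Metric.eventually_nhds_iff.1 (h1.and h2)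
    filter_upwards [Ioo_mem_nhdsGT hs] with s' hs'
    refine ⟨fun x hx => (hball (y := x) (by rw [dist_eq_norm]; linarith [hs'.2])).1,
      fun x hx => ?_⟩
    have h3 := (hball (y := x) (by rw [dist_eq_norm]; linarith [hs'.2])).2
    rw [← hcn]
    refine h3 ?_
    rintro rfl
    simp at hx
    linarith [hs'.1]
  obtain ⟨σ, ⟨hσsmall, hσne⟩, hσ⟩ := (hsmall_ev.and self_mem_nhdsWithin).exists
  replace hσ : 0 < σ := hσ
  obtain ⟨μ, hμ, hμs⟩ : ∃ μ > 0, ∀ x, ‖x - c‖ = σ → μ ≤ ‖P x - port (i + 1)‖ := by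
    have hne : (sphere c σ).Nonempty := NormedSpace.sphere_nonempty.2 hσ.le
    obtain ⟨x₀, hx₀, hmin⟩ := (isCompact_sphere c σ).exists_isMinOn hne
      (f := fun x => ‖P x - port (i + 1)‖) (by
        have := hPd.continuous
        fun_prop)
    refine ⟨‖P x₀ - port (i + 1)‖, norm_pos_iff.2 (sub_ne_zero.2 (hσne x₀ ?_)), fun x hx => ?_⟩
    · exact mem_sphere_iff_norm.1 hx₀
    · exact hmin (mem_sphere_iff_norm.2 hx)
  -- With `μ / 2`, the image of the boundary circle stays at distance `2 * r'` from the next port;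
  -- with `1 / i`, the discs shrink.
  set r' := min (μ / 2) (1 / i) with hr'def
  have hr' : 0 < r' := lt_min (by linarith) (by positivity)
  have hr'μ : 2 * r' ≤ μ := by linarith [min_le_left (μ / 2) (1 / (i : ℝ))]
  obtain ⟨δ₀, hδ₀, hcore⟩ : ∃ δ₀ > 0, ∀ x, ‖x - c‖ ≤ δ₀ → ‖P x - port (i + 1)‖ ≤ r' / 4 := by
    obtain ⟨s, hs, hball⟩ := Metric.nhds_basis_closedBall.mem_iff.1
      (hPd.continuous.continuousAt.preimage_mem_nhds
        (closedBall_mem_nhds (P c) (show 0 < r' / 4 by positivity)))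
    refine ⟨s, hs, fun x hx => ?_⟩
    have := hball (mem_closedBall_iff_norm.2 hx)
    rw [Set.mem_preimage, hcn, mem_closedBall_iff_norm] at this
    exact this
  -- uniform openness of the map to `port i`
  have hcompact2 := isCompact_closedBall (port 2) 2
  obtain ⟨ρ₀, hρ₀, hρ₀c⟩ : ∃ ρ₀ > 0, ∀ w ∈ closedBall (port 2) 2, ∀ w' ∈ closedBall (port 2) 2,
      ‖w' - w‖ < ρ₀ → ∀ j < τ, ‖F^[j] w' - F^[j] w‖ ≤ 1 := by
    induction τ with
    | zero => exact ⟨1, one_pos, by simp⟩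
    | succ τ ih =>
      obtain ⟨ρ₁, hρ₁, H₁⟩ := ih
      have hj : Continuous F^[τ] := hF.continuous.iterate τ
      have huc := hcompact2.uniformContinuousOn_of_continuous hj.continuousOn
      rw [Metric.uniformContinuousOn_iff] at huc
      obtain ⟨ρ₂, hρ₂, H₂⟩ := huc 1 one_pos
      refine ⟨min ρ₁ ρ₂, lt_min hρ₁ hρ₂, fun w hw w' hw' hd j hjτ => ?_⟩
      rcases Nat.lt_succ_iff_lt_or_eq.1 hjτ with hlt | rfl
      · exact H₁ w hw w' hw' (hd.trans_le (min_le_left _ _)) j hlt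
      · have := H₂ w' hw' w hw (by rw [dist_eq_norm]; exact hd.trans_le (min_le_right _ _))
        rw [dist_eq_norm] at this
        exact this.le
  set ρ := min (min ρ₀ (1 / i)) 1 with hρdef
  have hρ : 0 < ρ := by positivity
  have hτc : Continuous F^[τ] := hF.continuous.iterate τ
  obtain ⟨δ₁, hδ₁, hopen⟩ := (hFo.iterate_map τ).exists_uniform_of_isCompact hτc
    (isCompact_closedBall (port 2) 1) hρ
  set δ := min (δ₁ / 2) (1 / 2) with hδdef
  have hδ : 0 < δ := by positivity
  have hδδ₁ : 2 * δ ≤ δ₁ := by linarith [min_le_left (δ₁ / 2) (1 / 2)]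
  obtain ⟨g, t, hg, -, ht, hg₁, hg₂, hg₃, hg₄⟩ := exists_power_map (a := port i) hbc hr hσ hδ hδ₀
  obtain ⟨ε, hε, Htransit⟩ := exists_transit_of_close hF.continuous hg.continuous hi (τ := τ)
    hr1 hr' hδ (min_le_right _ _) ((min_le_left _ _).trans (min_le_right _ _)) ht horb hσsmall
    (fun x hx => hr'μ.trans (hμs x hx)) hcore hg₁ hg₂ hg₃ hg₄
    (fun w hw y hy => hopen w hw y (hy.trans_le hδδ₁))
    (fun w hw w' hw' => hρ₀c w (closedBall_subset_closedBall (by norm_num) hw) w' (by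
        rw [mem_closedBall_iff_norm] at hw ⊢
        have h1 := norm_add_le (w' - w) (w - port 2)
        rw [sub_add_sub_cancel] at h1
        have h2 := hw'.trans_le (min_le_right (min ρ₀ (1 / (i : ℝ))) 1)
        linarith) (hw'.trans_le ((min_le_left _ _).trans (min_le_left _ _))))
  -- The same number serves as approximation error and as new tolerance `κ'`. Twice it is at most
  -- `ε`, and adding the earlier error `κ / 8` keeps the total below the old tolerance.
  obtain ⟨f', hf', hf'F, hf'g⟩ := exists_entire_port hF hg hi0
    (show 0 < min (ε / 2) (κ / 8) by positivity)
  have hle1 : min (ε / 2) (κ / 8) ≤ ε / 2 := min_le_left _ _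
  have hle2 : min (ε / 2) (κ / 8) ≤ κ / 8 := min_le_right _ _
  have hsub0 : closedBall (0 : ℂ) (siteRadius i / 8) ⊆ closedBall 0 (siteRadius (i + 1) / 8) :=
    closedBall_subset_closedBall (by
      have := siteRadius_strictMono.monotone (Nat.le_succ i)
      simp only [Nat.succ_eq_add_one] at this
      linarith)
  have hsubs : closedBall (site i) 2 ⊆ closedBall 0 (siteRadius (i + 1) / 8) :=
    (closedBall_site_subset (by omega) i.lt_succ_self (by norm_num)).trans
      (closedBall_sixteenth_subset _)
  have hsubp : closedBall (port i) 2 ⊆ closedBall 0 (siteRadius (i + 1) / 8) :=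
    (closedBall_port_subset (by omega) i.lt_succ_self (by norm_num)).trans
      (closedBall_sixteenth_subset _)
  have hchain : ∀ h : ℂ → ℂ,
      (∀ z ∈ closedBall 0 (siteRadius (i + 1) / 8), ‖h z - f' z‖ ≤ min (ε / 2) (κ / 8)) →
      ∀ z ∈ closedBall 0 (siteRadius i / 8) ∪ closedBall (site i) 2,
        ‖h z - F z‖ ≤ 2 * min (ε / 2) (κ / 8) := by
    intro h hh z hz
    have h1 := hh z (hz.elim (fun H => hsub0 H) fun H => hsubs H)
    have h2 := hf'F z hz
    have h3 := norm_add_le (h z - f' z) (f' z - F z)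
    rw [sub_add_sub_cancel] at h3
    linarith
  refine ⟨f', min (ε / 2) (κ / 8), r', ⟨hf', by positivity, by linarith, fun h hh => ?_⟩,
    by linarith, hr', min_le_right _ _, fun z hz => ?_, fun h hh => ?_⟩
  · have hold : NearModel i h := hf.nearModel h fun z hz => by
      have h1 := hchain h hh z (Or.inl hz)
      have h2 := hFf z hz
      have h3 := norm_add_le (h z - F z) (F z - f z)
      rw [sub_add_sub_cancel] at h3
      linarith
    refine ⟨fun j hj z hz => ?_, hold.2⟩
    rcases Nat.lt_succ_iff_lt_or_eq.1 hj with hj | rfl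
    · exact hold.1 j hj z hz
    · have h1 := hchain h hh z (Or.inr hz)
      have h2 := hFs z (closedBall_subset_closedBall (by norm_num) hz)
      have h3 := norm_add_le (h z - F z) (F z - 10000 * z)
      rw [sub_add_sub_cancel] at h3
      linarith
  · have h1 := hf'F z (Or.inl hz)
    have h2 := hFf z hz
    have h3 := norm_add_le (f' z - F z) (F z - f z)
    rw [sub_add_sub_cancel] at h3
    linarith
  · refine Htransit h (fun z hz => (hchain h hh z hz).trans (by linarith)) fun z hz => ?_
    have h1 := hh z (hsubp hz)
    have h2 := hf'g z hz
    have h3 := norm_add_le (h z - f' z) (f' z - g z)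
    rw [sub_add_sub_cancel] at h3
    linarith

/-! ### The limit function -/

open Metric in
/-- A sequence of entire functions with rapidly decreasing increments has an entire limit. -/
theorem exists_entire_limit {f : ℕ → ℂ → ℂ} {κ R : ℕ → ℝ} (hf : ∀ n, Differentiable ℂ (f n))
    (hκ : ∀ n, 0 < κ n) (hκ2 : ∀ n, κ (n + 1) ≤ κ n / 2) (hR : Monotone R)
    (hRtop : Tendsto R atTop atTop)
    (hstep : ∀ n, ∀ z ∈ closedBall (0 : ℂ) (R n), ‖f (n + 1) z - f n z‖ ≤ κ n / 2) :
    ∃ F : ℂ → ℂ, Differentiable ℂ F ∧ ∀ n, ∀ z ∈ closedBall (0 : ℂ) (R n), ‖F z - f n z‖ ≤ κ n := by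
  -- The sum telescopes because `κ n / 2 ≤ κ n - κ (n + 1)`.
  have htel : ∀ N k, ∀ z ∈ closedBall (0 : ℂ) (R N), ‖f (N + k) z - f N z‖ ≤ κ N - κ (N + k) := by
    intro N k z hz
    induction k with
    | zero => simp
    | succ k ih =>
      have h1 := hstep (N + k) z (closedBall_subset_closedBall (hR (Nat.le_add_right _ _)) hz)
      have h2 := hκ2 (N + k)
      have h3 := norm_add_le (f (N + k + 1) z - f (N + k) z) (f (N + k) z - f N z)
      rw [sub_add_sub_cancel] at h3
      rw [← add_assoc]
      linarith
  have hκlim : Tendsto κ atTop (𝓝 0) := by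
    have h1 : ∀ n, κ n ≤ κ 0 * (1 / 2) ^ n := by
      intro n
      induction n with
      | zero => simp
      | succ n ih => rw [pow_succ]; linarith [hκ2 n]
    have h2 : Tendsto (fun n : ℕ => κ 0 * (1 / 2 : ℝ) ^ n) atTop (𝓝 (κ 0 * 0)) :=
      (tendsto_pow_atTop_nhds_zero_of_lt_one (by norm_num) (by norm_num)).const_mul _
    rw [mul_zero] at h2
    exact squeeze_zero (fun n => (hκ n).le) h1 h2
  have hlim : ∀ z, ∃ l, Tendsto (fun n => f n z) atTop (𝓝 l) := by
    intro z
    refine cauchySeq_tendsto_of_complete ?_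
    rw [Metric.cauchySeq_iff']
    intro ε hε
    obtain ⟨N, hN1, hN2⟩ := ((hκlim.eventually (gt_mem_nhds hε)).and
      (hRtop.eventually_ge_atTop ‖z‖)).exists
    refine ⟨N, fun n hn => ?_⟩
    obtain ⟨k, rfl⟩ := Nat.exists_eq_add_of_le hn
    have := htel N k z (by rwa [mem_closedBall_zero_iff])
    rw [dist_eq_norm]
    linarith [hκ (N + k)]
  choose F hF using hlim
  have hclose : ∀ n, ∀ z ∈ closedBall (0 : ℂ) (R n), ‖F z - f n z‖ ≤ κ n := by
    intro n z hz
    have h1 : Tendsto (fun k => ‖f (k + n) z - f n z‖) atTop (𝓝 ‖F z - f n z‖) :=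
      (((tendsto_add_atTop_iff_nat n).2 (hF z)).sub_const _).norm
    refine le_of_tendsto' h1 fun k => ?_
    have := htel n k z hz
    rw [add_comm k n]
    linarith [hκ (n + k)]
  refine ⟨F, ?_, hclose⟩
  have hloc : TendstoLocallyUniformlyOn f F atTop Set.univ := by
    rw [Metric.tendstoLocallyUniformlyOn_iff]
    intro ε hε x _
    refine ⟨ball x 1, mem_nhdsWithin_of_mem_nhds (ball_mem_nhds x one_pos), ?_⟩
    filter_upwards [hκlim.eventually (gt_mem_nhds hε), hRtop.eventually_ge_atTop (‖x‖ + 1)]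
      with n h1 h2 y hy
    rw [dist_eq_norm]
    refine (hclose n y ?_).trans_lt h1
    rw [mem_closedBall_zero_iff]
    rw [mem_ball_iff_norm] at hy
    have := norm_add_le (y - x) x
    rw [sub_add_cancel] at this
    linarith
  exact differentiableOn_univ.1
    (hloc.differentiableOn (Eventually.of_forall fun n => (hf n).differentiableOn) isOpen_univ)

open Metric in
theorem exists_isStage_two : ∃ (f : ℂ → ℂ) (κ : ℝ), IsStage 2 f κ := by
  obtain ⟨f, hf, hf₁, hf₂⟩ := exists_entire_port (f := fun z => 10000 * z) (g := fun _ => port 1)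
    (by fun_prop) (by fun_prop) one_ne_zero (show (0 : ℝ) < 1 / 4 by norm_num)
  refine ⟨f, 1 / 4, hf, by norm_num, by norm_num, fun h hh => ⟨fun j hj z hz => ?_, fun z hz => ?_⟩⟩
  · have h1 := hh z (closedBall_sixteenth_subset 2 (closedBall_site_subset le_rfl hj
      (by norm_num) hz))
    have h2 := hf₁ z (by
      rcases (show j = 0 ∨ j = 1 by omega) with rfl | rfl
      · left
        refine closedBall_subset_closedBall ?_ (by simpa [site, siteRadius] using hz)
        norm_num [siteRadius]
      · exact Or.inr hz)
    have h3 := norm_add_le (h z - f z) (f z - 10000 * z)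
    rw [sub_add_sub_cancel] at h3
    linarith
  · have h1 := hh z (closedBall_sixteenth_subset 2 (closedBall_port_subset le_rfl one_lt_two
      (by norm_num) hz))
    have h2 := hf₂ z hz
    have h3 := norm_add_le (h z - f z) (f z - port 1)
    rw [sub_add_sub_cancel] at h3
    linarith

theorem natCast_le_siteRadius (n : ℕ) : (n : ℝ) ≤ siteRadius n := by
  induction n with
  | zero => simp [siteRadius]
  | succ n ih =>
    push_cast
    linarith [siteRadius_add_le n]

theorem tendsto_siteRadius : Tendsto siteRadius atTop atTop :=
  tendsto_atTop_mono natCast_le_siteRadius tendsto_natCast_atTop_atTop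

/-- The time at which the `k`-th excursion starts, if `m l` is the number of steps which the `l`-th
excursion spends near `0`. -/
def startTime (m : ℕ → ℕ) : ℕ → ℕ
  | 0 => 0
  | k + 1 => startTime m k + (m k + (k + 2) + 1)

/-- An entire function for which all excursions take place, with dwelling times `m`. -/
structure IsOscillator (m : ℕ → ℕ) (r : ℕ → ℝ) (f : ℂ → ℂ) : Prop where
  differentiable : Differentiable ℂ f
  nearModel : ∀ i, NearModel i f
  radius_pos : ∀ k, 0 < r k
  radius_zero : r 0 = 1
  radius_le : ∀ k, r k ≤ 1 / (k + 1)
  transit : ∀ k, Transit (k + 2) (m k) (startTime m k) (r k) (r (k + 1)) f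

/-- The stages are chosen recursively, the radius reached by one excursion being the starting radius
of the next. The limit is within tolerance of every stage, so it inherits every excursion. -/
theorem exists_isOscillator (m : ℕ → ℕ) : ∃ (r : ℕ → ℝ) (f : ℂ → ℂ), IsOscillator m r f := by
  let S : ℕ → Type := fun k =>
    {x : (ℂ → ℂ) × ℝ × ℝ // IsStage (k + 2) x.1 x.2.1 ∧ 0 < x.2.2 ∧ x.2.2 ≤ 1}
  have hnext : ∀ k (x : S k), ∃ y : S (k + 1), y.1.2.1 ≤ x.1.2.1 / 2 ∧ y.1.2.2 ≤ 1 / (k + 2 : ℕ) ∧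
      (∀ z ∈ Metric.closedBall 0 (siteRadius (k + 2) / 8), ‖y.1.1 z - x.1.1 z‖ ≤ x.1.2.1 / 2) ∧
      ∀ h : ℂ → ℂ, (∀ z ∈ Metric.closedBall 0 (siteRadius (k + 1 + 2) / 8),
        ‖h z - y.1.1 z‖ ≤ y.1.2.1) →
        Transit (k + 2) (m k) (startTime m k) x.1.2.2 y.1.2.2 h := by
    rintro k ⟨⟨f, κ, r⟩, hs, hr, hr1⟩
    obtain ⟨f', κ', r', h1, h2, h3, h4, h5, h6⟩ :=
      hs.exists_next (by omega) (m k) (startTime m k) hr hr1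
    refine ⟨⟨⟨f', κ', r'⟩, h1, h3, h4.trans ?_⟩, h2, h4, h5, h6⟩
    rw [div_le_one (by positivity)]
    push_cast
    linarith [(k.cast_nonneg : (0 : ℝ) ≤ k)]
  choose next hnext1 hnext2 hnext3 hnext4 using hnext
  obtain ⟨f₀, κ₀, h₀⟩ := exists_isStage_two
  let x : ∀ k, S k := fun k => Nat.rec (motive := S) ⟨⟨f₀, κ₀, 1⟩, h₀, one_pos, le_rfl⟩ next k
  obtain ⟨F, hF, hclose⟩ := exists_entire_limit (f := fun k => (x k).1.1)
    (κ := fun k => (x k).1.2.1) (R := fun k => siteRadius (k + 2) / 8)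
    (fun k => (x k).2.1.differentiable) (fun k => (x k).2.1.pos) (fun k => hnext1 k (x k))
    (monotone_nat_of_le_succ fun k => by
      have := siteRadius_add_le (k + 2)
      rw [show k + 1 + 2 = k + 2 + 1 by ring]
      linarith)
    (((tendsto_add_atTop_iff_nat 2).2 tendsto_siteRadius).atTop_div_const (by norm_num))
    (fun k => hnext3 k (x k))
  have hmodel : ∀ k, NearModel (k + 2) F := fun k => (x k).2.1.nearModel F (hclose k)
  refine ⟨fun k => (x k).1.2.2, F, hF, fun i => ⟨fun j hj => (hmodel i).1 j (by omega),
    (hmodel i).2⟩, fun k => (x k).2.2.1, rfl, fun k => ?_, fun k => ?_⟩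
  · cases k with
    | zero => exact (x 0).2.2.2.trans (by norm_num)
    | succ k =>
      refine (hnext2 k (x k)).trans_eq ?_
      push_cast
      ring
  · exact hnext4 k (x k) F (hclose (k + 1))

/-! ### Normality and escape along subsequences -/

/-- If escape failed at `b`, a subsequence would be bounded there. A normal limit of a further
subsequence is finite throughout `V`, which is false at `a`, or infinite throughout, which is false
at `b`. -/
theorem IsNormalFamilyOn.tendsto_norm_atTop {f : ℂ → ℂ} {V : Set ℂ}
    (hV : IsNormalFamilyOn (fun n : ℕ => f^[n]) V) {t : ℕ → ℕ} {a b : ℂ} (ha : a ∈ V) (hb : b ∈ V)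
    (hlim : Tendsto (fun k => ‖f^[t k] a‖) atTop atTop) :
    Tendsto (fun k => ‖f^[t k] b‖) atTop atTop := by
  by_contra hcon
  rw [tendsto_atTop] at hcon
  push Not at hcon
  obtain ⟨R, hR⟩ := hcon
  obtain ⟨φ, hφ, hφR⟩ := extraction_of_frequently_atTop hR
  obtain ⟨ψ, hψ, h⟩ := hV (t ∘ φ)
  have hlim' : Tendsto (fun k => ‖f^[t (φ (ψ k))] a‖) atTop atTop :=
    hlim.comp (hφ.tendsto_atTop.comp hψ.tendsto_atTop)
  rcases h with ⟨g, hg⟩ | h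
  · exact not_tendsto_nhds_of_tendsto_atTop hlim' _ (hg.tendsto_at ha).norm
  · obtain ⟨k, hk⟩ := (h {b} (by simpa using hb) isCompact_singleton R).exists
    have h1 := hk b rfl
    have h2 := hφR (ψ k)
    simp only [Function.comp_apply] at h1 h2
    linarith

/-- If a subsequence of the iterates tends to infinity at a point of a connected subset of the Fatou
set, then it does so at all points of the set. -/
theorem IsPreconnected.tendsto_norm_iterate_atTop {f : ℂ → ℂ} {U : Set ℂ} (hU : IsPreconnected U)
    (hUF : U ⊆ fatouSet f) {t : ℕ → ℕ} {a b : ℂ} (ha : a ∈ U) (hb : b ∈ U)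
    (hlim : Tendsto (fun k => ‖f^[t k] a‖) atTop atTop) :
    Tendsto (fun k => ‖f^[t k] b‖) atTop atTop := by
  let E : Set ℂ := {z | Tendsto (fun k => ‖f^[t k] z‖) atTop atTop}
  have hE : ∀ z ∈ U, z ∈ interior E ∪ interior Eᶜ := by
    intro z hz
    obtain ⟨V, hV, hzV, hn⟩ := hUF hz
    by_cases hzE : z ∈ E
    · exact Or.inl (mem_interior.2
        ⟨V, fun w hw => hn.tendsto_norm_atTop hzV hw hzE, hV.1, hzV⟩)
    · exact Or.inr (mem_interior.2
        ⟨V, fun w hw hwE => hzE (hn.tendsto_norm_atTop hw hzV hwE), hV.1, hzV⟩)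
  rcases isPreconnected_iff_subset_of_disjoint.1 hU _ _ isOpen_interior isOpen_interior hE (by
    rw [Set.eq_empty_iff_forall_notMem]
    rintro z ⟨-, h1, h2⟩
    exact (interior_subset h2) (interior_subset h1)) with h | h
  · exact interior_subset (s := E) (h hb)
  · exact absurd hlim (interior_subset (h ha))

/-- A sequence of maps which contracts `V` is normal on `V`. -/
theorem isNormalFamilyOn_of_contracting {F : ℕ → ℂ → ℂ} {V : Set ℂ} {z₀ : ℂ}
    (h : ∀ ε > 0, ∀ᶠ n in atTop, ∀ w ∈ V, ‖F n w - F n z₀‖ ≤ ε) : IsNormalFamilyOn F V := by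
  intro s
  -- Either some index recurs infinitely often and gives a constant subsequence, or `s` tends to
  -- infinity and the contraction applies.
  by_cases hs : ∃ n, ∃ᶠ k in atTop, s k = n
  · obtain ⟨n, hn⟩ := hs
    obtain ⟨φ, hφ, hφn⟩ := extraction_of_frequently_atTop hn
    refine ⟨φ, hφ, Or.inl ⟨F n, fun u hu x hx => ⟨V, self_mem_nhdsWithin,
      Eventually.of_forall fun k y _ => ?_⟩⟩⟩
    simp only [hφn]
    exact refl_mem_uniformity hu
  · push Not at hs
    have hsatTop : Tendsto s atTop atTop := by
      rw [← Nat.cofinite_eq_atTop, tendsto_def]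
      intro A hA
      have h1 : ∀ᶠ k in atTop, ∀ n ∈ Aᶜ, s k ≠ n := (Set.Finite.eventually_all hA).2 fun n _ => hs n
      rw [Nat.cofinite_eq_atTop]
      filter_upwards [h1] with k hk
      by_contra hkA
      exact hk _ hkA rfl
    by_cases hinf : Tendsto (fun k => ‖F (s k) z₀‖) atTop atTop
    · refine ⟨id, strictMono_id, Or.inr fun K hK _ R => ?_⟩
      filter_upwards [hsatTop.eventually (h 1 one_pos), hinf.eventually_gt_atTop (R + 1)]
        with k hk1 hk2 z hz
      have h1 := hk1 z (hK hz)
      have h2 := norm_sub_norm_le (F (s k) z₀) (F (s k) z)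
      rw [norm_sub_rev] at h2
      simp only [id]
      linarith
    · rw [tendsto_atTop] at hinf
      push Not at hinf
      obtain ⟨R, hR⟩ := hinf
      obtain ⟨l, -, φ, hφ, hl⟩ := tendsto_subseq_of_frequently_bounded
        (Metric.isBounded_closedBall (x := (0 : ℂ)) (r := R)) (x := fun k => F (s k) z₀)
        (hR.mono fun k hk => by rw [mem_closedBall_zero_iff]; exact hk.le)
      refine ⟨φ, hφ, Or.inl ⟨fun _ => l, ?_⟩⟩
      rw [Metric.tendstoLocallyUniformlyOn_iff]
      intro ε hε x _
      refine ⟨V, self_mem_nhdsWithin, ?_⟩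
      filter_upwards [(hsatTop.comp hφ.tendsto_atTop).eventually (h (ε / 2) (half_pos hε)),
        hl.eventually (Metric.ball_mem_nhds l (half_pos hε))] with k hk1 hk2 y hy
      have h1 := hk1 y hy
      rw [← dist_eq_norm] at h1
      have h2 := dist_triangle (F (s (φ k)) y) (F (s (φ k)) z₀) l
      rw [dist_comm]
      simp only [Function.comp_apply] at h1 hk2 ⊢
      linarith

/-! ### The Fatou component and its itinerary -/

theorem lt_norm_port_sub_site (p q : ℕ) : 4 < ‖port p - site q‖ := by
  have e : port p - site q = ((siteRadius p - siteRadius q + 32 : ℝ) : ℂ) := by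
    simp only [port, site]; push_cast; ring
  rw [e, Complex.norm_real, Real.norm_eq_abs, lt_abs]
  rcases lt_trichotomy p q with h | rfl | h
  · right; linarith [siteRadius_add_le_of_lt h]
  · left; norm_num
  · left; linarith [siteRadius_add_le_of_lt h]

theorem lt_norm_port_sub_port {p q : ℕ} (hpq : p ≠ q) : 4 < ‖port p - port q‖ := by
  have e : port p - port q = ((siteRadius p - siteRadius q : ℝ) : ℂ) := by
    simp only [port, site]; push_cast; ring
  rw [e, Complex.norm_real, Real.norm_eq_abs, lt_abs]
  rcases hpq.lt_or_gt with h | h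
  · right; linarith [siteRadius_add_le_of_lt h]
  · left; linarith [siteRadius_add_le_of_lt h]

theorem norm_port (n : ℕ) : ‖port n‖ = siteRadius n + 32 := by
  have e : port n = ((siteRadius n + 32 : ℝ) : ℂ) := by simp only [port, site]; push_cast; ring
  rw [e, Complex.norm_real, Real.norm_of_nonneg (by linarith [siteRadius_nonneg n])]

theorem startTime_lt_succ (m : ℕ → ℕ) (k : ℕ) : startTime m k < startTime m (k + 1) := by
  simp only [startTime]; omega

theorem startTime_strictMono (m : ℕ → ℕ) : StrictMono (startTime m) :=
  strictMono_nat_of_lt_succ (startTime_lt_succ m)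

theorem exists_eq_startTime_add (m : ℕ → ℕ) (n : ℕ) :
    ∃ k j, n = startTime m k + j ∧ j ≤ m k + (k + 2) := by
  induction n with
  | zero => exact ⟨0, 0, rfl, Nat.zero_le _⟩
  | succ n ih =>
    obtain ⟨k, j, rfl, hj⟩ := ih
    rcases hj.lt_or_eq with hj | rfl
    · exact ⟨k, j + 1, rfl, hj⟩
    · exact ⟨k + 1, 0, rfl, Nat.zero_le _⟩

namespace IsOscillator

open Metric

variable {m : ℕ → ℕ} {r : ℕ → ℝ} {f : ℂ → ℂ}

theorem radius_le_one (hf : IsOscillator m r f) (k : ℕ) : r k ≤ 1 := by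
  refine (hf.radius_le k).trans ?_
  rw [div_le_one (by positivity)]
  linarith [(k.cast_nonneg : (0 : ℝ) ≤ k)]

/-- The points which follow all excursions. -/
def followers (m : ℕ → ℕ) (r : ℕ → ℝ) (f : ℂ → ℂ) : Set ℂ :=
  {w | ∀ k, f^[startTime m k] w ∈ closedBall (port (k + 2)) (r k)}

theorem mem_site (hf : IsOscillator m r f) {k j : ℕ} {y : ℂ} (hy : y ∈ closedBall (port (k + 2)) (r k))
    (hj1 : 1 ≤ j) (hj : j ≤ m k + (k + 2)) : f^[j] y ∈ closedBall (site (j - m k)) 2 := by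
  obtain ⟨p, hp, H⟩ := (hf.transit k).itinerary j hj1 hj
  have h1 := H y hy
  have h2 : 1 / ((k + 2 : ℕ) : ℝ) ≤ 1 := by
    rw [div_le_one (by positivity)]
    push_cast
    linarith [(k.cast_nonneg : (0 : ℝ) ≤ k)]
  rw [mem_closedBall_iff_norm] at hp ⊢
  have h3 := norm_add_le (f^[j] y - p) (p - site (j - m k))
  rw [sub_add_sub_cancel] at h3
  linarith

theorem iterate_mem_of_forall_lt (hf : IsOscillator m r f) {k : ℕ} {w : ℂ}
    (hw : ∀ l < k, f^[startTime m l] w ∈ closedBall (port (l + 2)) (r l)) {n : ℕ}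
    (hn : n < startTime m k) : f^[n] w ∈ closedBall 0 (siteRadius (k + 2) / 16) := by
  obtain ⟨l, j, rfl, hj⟩ := exists_eq_startTime_add m n
  have hlk : l < k := (startTime_strictMono m).lt_iff_lt.1 (by omega)
  rcases Nat.eq_zero_or_pos j with rfl | hj0
  · refine closedBall_port_subset (by omega) (show l + 2 < k + 2 by omega) ?_ (hw l hlk)
    linarith [hf.radius_le_one l]
  · rw [add_comm (startTime m l), Function.iterate_add_apply]
    exact closedBall_site_subset (by omega) (show j - m l < k + 2 by omega) (by norm_num)
      (hf.mem_site (hw l hlk) hj0 hj)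

theorem iterate_mem_trap (hf : IsOscillator m r f) {N : ℕ} {w : ℂ}
    (hw : f^[N] w ∈ closedBall (port 1) 1) (k : ℕ) : f^[k + N] w ∈ closedBall (port 1) 1 := by
  induction k with
  | zero => simpa using hw
  | succ k ih =>
    rw [Nat.succ_add, Function.iterate_succ_apply', mem_closedBall_iff_norm]
    exact ((hf.nearModel 0).2 _ (closedBall_subset_closedBall (by norm_num) ih)).trans (by norm_num)

theorem not_tendsto_of_mem_trap (hf : IsOscillator m r f) {N : ℕ} {w : ℂ}
    (hw : f^[N] w ∈ closedBall (port 1) 1) :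
    ¬ Tendsto (fun k => ‖f^[startTime m k] w‖) atTop atTop := by
  intro h
  obtain ⟨k, hk1, hk2⟩ := ((h.eventually_gt_atTop (‖port 1‖ + 1)).and
    ((startTime_strictMono m).tendsto_atTop.eventually_ge_atTop N)).exists
  have h1 := hf.iterate_mem_trap hw (startTime m k - N)
  rw [Nat.sub_add_cancel hk2, mem_closedBall_iff_norm] at h1
  have h2 := norm_add_le (f^[startTime m k] w - port 1) (port 1)
  rw [sub_add_cancel] at h2
  linarith

theorem norm_iterate_le_of_mem_ball (hf : IsOscillator m r f) {w : ℂ} (hw : w ∈ ball (port 2) (1 / 2))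
    (k : ℕ) : ‖f^[startTime m k] w - port (k + 2)‖ ≤ r k / 2 := by
  induction k with
  | zero =>
    rw [hf.radius_zero]
    exact (mem_ball_iff_norm.1 hw).le
  | succ k ih =>
    rw [startTime, add_comm, Function.iterate_add_apply]
    exact (hf.transit k).core _ ih

theorem ball_subset_followers (hf : IsOscillator m r f) :
    ball (port 2) (1 / 2) ⊆ followers m r f := fun w hw k => by
  rw [mem_closedBall_iff_norm]
  linarith [hf.norm_iterate_le_of_mem_ball hw k, hf.radius_pos k]

theorem port_mem_followers (hf : IsOscillator m r f) : port 2 ∈ followers m r f :=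
  hf.ball_subset_followers (mem_ball_self (by norm_num))

theorem tendsto_norm_of_mem_followers (hf : IsOscillator m r f) {w : ℂ}
    (hw : w ∈ followers m r f) : Tendsto (fun k => ‖f^[startTime m k] w‖) atTop atTop := by
  refine tendsto_atTop_mono (fun k => ?_) ((tendsto_add_atTop_iff_nat 2).2 tendsto_siteRadius)
  have h1 := hw k
  rw [mem_closedBall_iff_norm] at h1
  have h2 := norm_sub_norm_le (port (k + 2)) (f^[startTime m k] w)
  rw [norm_port, norm_sub_rev] at h2
  linarith [hf.radius_le_one k]

/-- During the `k`-th excursion all followers are within `1 / (k + 1)` of a common point at each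
time, so the iterates contract the disc. -/
theorem isNormalFamilyOn_ball (hf : IsOscillator m r f) :
    IsNormalFamilyOn (fun n : ℕ => f^[n]) (ball (port 2) (1 / 2)) := by
  have hsmall : ∀ k j, j ≤ m k + (k + 2) → ∀ w ∈ followers m r f,
      ‖f^[startTime m k + j] w - f^[startTime m k + j] (port 2)‖ ≤ 2 * (1 / (k + 1)) := by
    intro k j hj w hw
    rw [add_comm, Function.iterate_add_apply, Function.iterate_add_apply]
    have h0 := hf.port_mem_followers k
    have hw := hw k
    obtain ⟨p, hp1, hp2⟩ : ∃ p, ‖f^[j] (f^[startTime m k] w) - p‖ ≤ 1 / (k + 1) ∧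
        ‖f^[j] (f^[startTime m k] (port 2)) - p‖ ≤ 1 / (k + 1) := by
      rcases Nat.eq_zero_or_pos j with rfl | hj0
      · exact ⟨port (k + 2), (mem_closedBall_iff_norm.1 hw).trans (hf.radius_le k),
          (mem_closedBall_iff_norm.1 h0).trans (hf.radius_le k)⟩
      · obtain ⟨p, -, H⟩ := (hf.transit k).itinerary j hj0 hj
        have h2 : 1 / ((k + 2 : ℕ) : ℝ) ≤ 1 / (k + 1) := by
          refine one_div_le_one_div_of_le (by positivity) ?_
          push_cast
          linarith
        exact ⟨p, (H _ hw).trans h2, (H _ h0).trans h2⟩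
    have h3 := norm_sub_le (f^[j] (f^[startTime m k] w) - p)
      (f^[j] (f^[startTime m k] (port 2)) - p)
    rw [sub_sub_sub_cancel_right] at h3
    linarith
  refine isNormalFamilyOn_of_contracting (z₀ := port 2) fun ε hε => ?_
  have hlim : Tendsto (fun k : ℕ => 1 / ((k : ℝ) + 1)) atTop (𝓝 0) :=
    tendsto_one_div_add_atTop_nhds_zero_nat
  obtain ⟨k₀, hk₀⟩ := eventually_atTop.1 (hlim.eventually (gt_mem_nhds (half_pos hε)))
  filter_upwards [eventually_ge_atTop (startTime m k₀)] with n hn w hw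
  obtain ⟨k, j, rfl, hj⟩ := exists_eq_startTime_add m n
  have hk : k₀ ≤ k := by
    have h1 : startTime m k₀ < startTime m (k + 1) := by
      rw [startTime]; omega
    exact Nat.lt_succ_iff.1 ((startTime_strictMono m).lt_iff_lt.1 h1)
  have := hsmall k j hj w (hf.ball_subset_followers hw)
  linarith [hk₀ k hk]

theorem isPlaneDomain_ball (c : ℂ) {s : ℝ} (hs : 0 < s) : IsPlaneDomain (ball c s) :=
  ⟨isOpen_ball, (convex_ball c s).isConnected ⟨c, mem_ball_self hs⟩⟩

theorem port_mem_fatouSet (hf : IsOscillator m r f) : port 2 ∈ fatouSet f :=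
  ⟨_, isPlaneDomain_ball _ (by norm_num), mem_ball_self (by norm_num), hf.isNormalFamilyOn_ball⟩

/-- A point on the boundary circle would miss the next disc. Membership in the open disc is an open
condition, so nearby points follow any given finite number of excursions. -/
theorem mem_ball_of_mem_followers (hf : IsOscillator m r f) {w : ℂ} (hw : w ∈ followers m r f)
    (k : ℕ) : f^[startTime m k] w ∈ ball (port (k + 2)) (r k) := by
  have h1 := mem_closedBall_iff_norm.1 (hw k)
  rw [mem_ball_iff_norm]
  refine lt_of_le_of_ne h1 fun heq => ?_
  have h2 := (hf.transit k).boundary _ heq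
  have h3 := mem_closedBall_iff_norm.1 (hw (k + 1))
  rw [startTime, add_comm, Function.iterate_add_apply] at h3
  linarith

/-- Close to every boundary point of the set of followers there are trapped points. -/
theorem exists_trapped_near (hf : IsOscillator m r f) {z : ℂ} (hz : z ∈ followers m r f)
    (hzi : z ∉ interior (followers m r f)) {ε : ℝ} (hε : 0 < ε) :
    ∃ w ∈ ball z ε, ∃ N, f^[N] w ∈ closedBall (port 1) 1 := by
  have hlim : Tendsto (fun k : ℕ => 1 / ((k : ℝ) + 1)) atTop (𝓝 0) :=
    tendsto_one_div_add_atTop_nhds_zero_nat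
  obtain ⟨k₀, hk₀⟩ := (hlim.eventually (gt_mem_nhds (half_pos hε))).exists
  have hev : ∀ᶠ w in 𝓝 z, ∀ l ≤ k₀, f^[startTime m l] w ∈ closedBall (port (l + 2)) (r l) := by
    have := (Set.finite_le_nat k₀).eventually_all (l := 𝓝 z)
      (p := fun l w => f^[startTime m l] w ∈ closedBall (port (l + 2)) (r l))
    refine this.2 fun l _ => ?_
    have hc : Continuous f^[startTime m l] := hf.differentiable.continuous.iterate _
    filter_upwards [hc.continuousAt.preimage_mem_nhds
      (isOpen_ball.mem_nhds (hf.mem_ball_of_mem_followers hz l))] with w hw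
    exact ball_subset_closedBall hw
  have hfreq : ∃ᶠ w in 𝓝 z, w ∉ followers m r f := by
    intro h
    refine hzi (mem_interior_iff_mem_nhds.2 ?_)
    filter_upwards [h] with w hw
    simpa using hw
  obtain ⟨w, hwf, hwl, hwz⟩ :=
    (hfreq.and_eventually (hev.and (ball_mem_nhds z (half_pos hε)))).exists
  have hex : ∃ l, f^[startTime m l] w ∉ closedBall (port (l + 2)) (r l) := by
    simpa [followers] using hwf
  classical
  have hspec := Nat.find_spec hex
  have hmin : ∀ l < Nat.find hex, f^[startTime m l] w ∈ closedBall (port (l + 2)) (r l) :=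
    fun l hl => not_not.1 (Nat.find_min hex hl)
  have hk : k₀ < Nat.find hex := by
    by_contra! hle
    exact hspec (hwl _ hle)
  -- The first missed disc has index `l + 1 > k₀`, so the excursion `l` starts correctly and fails;
  -- its collar property gives a trapped point within `1 / (l + 2)`.
  obtain ⟨l, hl⟩ := Nat.exists_eq_succ_of_ne_zero (show Nat.find hex ≠ 0 by omega)
  rw [Nat.succ_eq_add_one] at hl
  rw [hl] at hspec hmin hk
  obtain ⟨w', hw', htrap⟩ := (hf.transit l).collar w
    (by have := hmin 0 (Nat.succ_pos l); rwa [hf.radius_zero] at this)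
    (fun j hj => hf.iterate_mem_of_forall_lt (fun i hi => hmin i (by omega)) hj)
    (hmin l (Nat.lt_succ_self l)) hspec
  refine ⟨w', ?_, _, htrap⟩
  have h1 : 1 / ((l + 2 : ℕ) : ℝ) ≤ 1 / (k₀ + 1) := by
    refine one_div_le_one_div_of_le (by positivity) ?_
    have : (k₀ : ℝ) ≤ l := by exact_mod_cast Nat.lt_succ_iff.1 hk
    push_cast
    linarith
  rw [dist_eq_norm] at hwz
  rw [mem_ball_iff_norm]
  have h2 := norm_add_le (w' - w) (w - z)
  rw [sub_add_sub_cancel] at h2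
  linarith

/-- The Fatou component of the starting point. -/
def component (f : ℂ → ℂ) : Set ℂ := connectedComponentIn (fatouSet f) (port 2)

theorem port_mem_component (hf : IsOscillator m r f) : port 2 ∈ component f :=
  mem_connectedComponentIn hf.port_mem_fatouSet

/-- The component contains no boundary point of the followers: near one there would be a trapped
point of the component, although escape along the start times spreads from `port 2` to the whole
component. Connectedness does the rest. -/
theorem component_subset_followers (hf : IsOscillator m r f) : component f ⊆ followers m r f := by
  have hK : IsClosed (followers m r f) := by
    have : followers m r f = ⋂ k, f^[startTime m k] ⁻¹' closedBall (port (k + 2)) (r k) := by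
      ext w; simp [followers]
    rw [this]
    exact isClosed_iInter fun k =>
      isClosed_closedBall.preimage (hf.differentiable.continuous.iterate _)
  have hU : IsPreconnected (component f) := isPreconnected_connectedComponentIn
  have hUF : component f ⊆ fatouSet f := connectedComponentIn_subset _ _
  have hcover : component f ⊆ interior (followers m r f) ∪ (followers m r f)ᶜ := by
    intro z hz
    by_contra hcon
    rw [Set.mem_union, not_or, Set.mem_compl_iff, not_not] at hcon
    obtain ⟨V, hV, hzV, hn⟩ := hUF hz
    have hVF : V ⊆ fatouSet f := fun w hw => ⟨V, hV, hw, hn⟩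
    have hVU : V ⊆ component f := by
      rw [component, connectedComponentIn_eq hz]
      exact hV.2.isPreconnected.subset_connectedComponentIn hzV hVF
    obtain ⟨ε, hε, hball⟩ := Metric.isOpen_iff.1 hV.1 z hzV
    obtain ⟨w, hw, N, hN⟩ := hf.exists_trapped_near hcon.2 hcon.1 hε
    exact hf.not_tendsto_of_mem_trap hN (hU.tendsto_norm_iterate_atTop hUF hf.port_mem_component
      (hVU (hball hw)) (hf.tendsto_norm_of_mem_followers hf.port_mem_followers))
  rcases isPreconnected_iff_subset_of_disjoint.1 hU _ _ isOpen_interior hK.isOpen_compl hcover (by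
    rw [Set.eq_empty_iff_forall_notMem]
    rintro z ⟨-, h1, h2⟩
    exact h2 (interior_subset h1)) with h | h
  · exact h.trans interior_subset
  · exact absurd hf.port_mem_followers (h hf.port_mem_component)

theorem eq_of_iterate_eq (hf : IsOscillator m r f) {x y : ℂ} (hx : x ∈ followers m r f)
    (hy : y ∈ followers m r f) {n n' : ℕ} (hn : n < n') (h : f^[n] x = f^[n'] y) : False := by
  -- Both orbits are pushed forward until `x` is at `port (k + 2)`. The orbit of `y` is then at a
  -- strictly later time, hence near a site or a different port.
  obtain ⟨k, hk⟩ := ((startTime_strictMono m).tendsto_atTop.eventually_ge_atTop n).exists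
  obtain ⟨t, ht⟩ := Nat.exists_eq_add_of_le' hk
  have h1 : f^[startTime m k] x = f^[t + n'] y := by
    rw [ht, Function.iterate_add_apply, h, Function.iterate_add_apply]
  have h2 := hx k
  rw [h1] at h2
  replace h2 := (mem_closedBall_iff_norm.1 h2).trans (hf.radius_le_one k)
  obtain ⟨k', j, hkj, hj⟩ := exists_eq_startTime_add m (t + n')
  rw [hkj] at h2
  rcases Nat.eq_zero_or_pos j with rfl | hj0
  · have hkk : k + 2 ≠ k' + 2 := by
      intro hcon
      have : k = k' := by omega
      subst this
      omega
    have h3 := (mem_closedBall_iff_norm.1 (hy k')).trans (hf.radius_le_one k')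
    have h4 := lt_norm_port_sub_port hkk
    rw [add_zero] at h2
    have h5 := norm_sub_le (f^[startTime m k'] y - port (k' + 2))
      (f^[startTime m k'] y - port (k + 2))
    rw [sub_sub_sub_cancel_left] at h5
    linarith
  · have h3 := hf.mem_site (hy k') hj0 hj
    rw [← Function.iterate_add_apply, add_comm j, mem_closedBall_iff_norm] at h3
    have h4 := lt_norm_port_sub_site (k + 2) (j - m k')
    have h5 := norm_sub_le (f^[startTime m k' + j] y - site (j - m k'))
      (f^[startTime m k' + j] y - port (k + 2))
    rw [sub_sub_sub_cancel_left] at h5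
    linarith

theorem isWanderingDomain (hf : IsOscillator m r f) : IsWanderingDomain f (component f) := by
  refine ⟨⟨port 2, hf.port_mem_fatouSet, rfl⟩, ?_⟩
  rintro n n' ⟨_, ⟨x, hx, rfl⟩, ⟨y, hy, hxy⟩⟩
  have hx' := hf.component_subset_followers hx
  have hy' := hf.component_subset_followers hy
  rcases lt_trichotomy n n' with h | h | h
  · exact (hf.eq_of_iterate_eq hx' hy' h hxy.symm).elim
  · exact h
  · exact (hf.eq_of_iterate_eq hy' hx' h hxy).elim

/-- The component is near `0` exactly during the dwelling times. -/
theorem image_component_subset_iff (hf : IsOscillator m r f) (n : ℕ) :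
    f^[n] '' component f ⊆ ball 0 100 ↔ ∃ k, startTime m k < n ∧ n ≤ startTime m k + m k := by
  constructor
  · intro h
    obtain ⟨k, j, rfl, hj⟩ := exists_eq_startTime_add m n
    have h0 := h (Set.mem_image_of_mem _ hf.port_mem_component)
    rw [mem_ball_zero_iff] at h0
    have hp := hf.port_mem_followers k
    have hj0 : j ≠ 0 := by
      rintro rfl
      have h1 := (mem_closedBall_iff_norm.1 hp).trans (hf.radius_le_one k)
      have h2 := norm_sub_norm_le (port (k + 2)) (f^[startTime m k] (port 2))
      rw [norm_port, norm_sub_rev] at h2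
      rw [add_zero] at h0
      linarith [siteRadius_succ_ge (k + 1)]
    refine ⟨k, by omega, ?_⟩
    by_contra! hcon
    have h1 := hf.mem_site hp (by omega) hj
    rw [← Function.iterate_add_apply, add_comm j, mem_closedBall_iff_norm] at h1
    have h2 := norm_sub_norm_le (site (j - m k)) (f^[startTime m k + j] (port 2))
    rw [norm_site, norm_sub_rev] at h2
    linarith [siteRadius_ge (show j - m k ≠ 0 by omega)]
  · rintro ⟨k, hk1, hk2⟩ _ ⟨w, hw, rfl⟩
    obtain ⟨j, rfl⟩ := Nat.exists_eq_add_of_le hk1.le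
    have h1 := hf.mem_site (hf.component_subset_followers hw k) (show 1 ≤ j by omega)
      (show j ≤ m k + (k + 2) by omega)
    rw [← Function.iterate_add_apply, add_comm j, show j - m k = 0 by omega,
      mem_closedBall_iff_norm] at h1
    rw [mem_ball_zero_iff]
    simp only [site, siteRadius, Complex.ofReal_zero, sub_zero] at h1
    linarith

/-- The function is bounded along the ports, which tend to infinity, so a polynomial would have to
be constant; its value at `site 1` is too large for that. -/
theorem isTranscendentalEntire (hf : IsOscillator m r f) : IsTranscendentalEntire f := by
  refine ⟨hf.differentiable, ?_⟩
  rintro ⟨p, hp⟩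
  have hport : ∀ k, ‖f (port (k + 2))‖ ≤ 1002 := by
    intro k
    have h1 := hf.mem_site (k := k) (mem_closedBall_self (hf.radius_pos k).le) le_rfl (by omega)
    rw [Function.iterate_one, mem_closedBall_iff_norm] at h1
    have h2 := norm_add_le (f (port (k + 2)) - site (1 - m k)) (site (1 - m k))
    have h3 : siteRadius (1 - m k) ≤ siteRadius 1 := siteRadius_strictMono.monotone (by omega)
    rw [sub_add_cancel, norm_site] at h2
    have h4 : siteRadius 1 = 1000 := by simp [siteRadius]
    linarith
  have hsite : ∀ n, 10000 * siteRadius n - 1 ≤ ‖f (site n)‖ := by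
    intro n
    have h1 := (hf.nearModel (n + 1)).1 n n.lt_succ_self _ (mem_closedBall_self (by norm_num))
    have h2 := norm_sub_norm_le (10000 * site n) (f (site n))
    rw [norm_sub_rev, norm_mul, norm_site] at h2
    norm_num at h2
    linarith
  rcases lt_or_ge 0 p.degree with hdeg | hdeg
  · have h1 : Tendsto (fun k => ‖port (k + 2)‖) atTop atTop := by
      simp only [norm_port]
      exact tendsto_atTop_add_const_right _ _
        ((tendsto_add_atTop_iff_nat 2).2 tendsto_siteRadius)
    obtain ⟨k, hk⟩ := ((p.tendsto_norm_atTop hdeg h1).eventually_gt_atTop 1002).exists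
    rw [← hp] at hk
    linarith [hport k]
  · rw [Polynomial.eq_C_of_degree_le_zero hdeg] at hp
    simp only [Polynomial.eval_C] at hp
    have h1 := hport 0
    have h2 := hsite 1
    rw [hp] at h1 h2
    norm_num [siteRadius] at h2
    linarith

end IsOscillator

theorem exists_wandering_of_dwelling (m : ℕ → ℕ) :
    ∃ (f : ℂ → ℂ) (U D : Set ℂ), IsTranscendentalEntire f ∧ IsWanderingDomain f U ∧
      IsPlaneDomain D ∧ Bornology.IsBounded D ∧
      ∀ n, f^[n] '' U ⊆ D ↔ ∃ k, startTime m k < n ∧ n ≤ startTime m k + m k := by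
  obtain ⟨r, f, hf⟩ := exists_isOscillator m
  exact ⟨f, IsOscillator.component f, Metric.ball 0 100, hf.isTranscendentalEntire,
    hf.isWanderingDomain, IsOscillator.isPlaneDomain_ball _ (by norm_num), Metric.isBounded_ball,
    hf.image_component_subset_iff⟩

/-! ### Dwelling times of prescribed density -/

/-- The number of steps which the first `k` excursions spend away from `0`. -/
def outTime : ℕ → ℕ
  | 0 => 0
  | k + 1 => outTime k + (k + 3)

theorem le_outTime (k : ℕ) : k ≤ outTime k := by
  induction k with
  | zero => exact le_rfl
  | succ k ih => simp only [outTime]; omega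

theorem two_mul_outTime (k : ℕ) : 2 * outTime k = k * (k + 5) := by
  induction k with
  | zero => rfl
  | succ k ih => rw [outTime, mul_add, ih]; ring

/-- The number of steps which the first `k` excursions are meant to spend near `0`. -/
noncomputable def dwellTotal (lam : ℝ) (k : ℕ) : ℕ :=
  ⌊lam * k / (k * (1 - lam) + 1) * outTime k⌋₊

theorem dwellTotal_zero (lam : ℝ) : dwellTotal lam 0 = 0 := by simp [dwellTotal]

theorem dwellTotal_mono {lam : ℝ} (h0 : 0 ≤ lam) (h1 : lam ≤ 1) : Monotone (dwellTotal lam) := by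
  refine monotone_nat_of_le_succ fun k => Nat.floor_mono ?_
  have hk : (0 : ℝ) ≤ k := k.cast_nonneg
  have hl : 0 ≤ 1 - lam := by linarith
  have hd : 0 < k * (1 - lam) + 1 := by positivity
  have hd' : 0 < ((k + 1 : ℕ) : ℝ) * (1 - lam) + 1 := by positivity
  refine mul_le_mul ?_ ?_ (by positivity) (by positivity)
  · rw [div_le_div_iff₀ hd hd']
    push_cast
    nlinarith
  · simp only [outTime]
    push_cast
    linarith

/-- The number of steps which the `k`-th excursion spends near `0`. -/
noncomputable def dwell (lam : ℝ) (k : ℕ) : ℕ := dwellTotal lam (k + 1) - dwellTotal lam k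

theorem dwellTotal_succ {lam : ℝ} (h0 : 0 ≤ lam) (h1 : lam ≤ 1) (k : ℕ) :
    dwellTotal lam (k + 1) = dwellTotal lam k + dwell lam k := by
  have := dwellTotal_mono h0 h1 (Nat.le_succ k)
  simp only [Nat.succ_eq_add_one] at this
  rw [dwell]; omega

theorem startTime_dwell {lam : ℝ} (h0 : 0 ≤ lam) (h1 : lam ≤ 1) (k : ℕ) :
    startTime (dwell lam) k = dwellTotal lam k + outTime k := by
  induction k with
  | zero => simp [startTime, dwellTotal_zero, outTime]
  | succ k ih => rw [startTime, ih, dwellTotal_succ h0 h1, outTime]; ring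

theorem startTime_add_mem_iff (m : ℕ → ℕ) {k j : ℕ} (hj : j ≤ m k + (k + 2)) :
    (∃ l, startTime m l < startTime m k + j ∧ startTime m k + j ≤ startTime m l + m l) ↔
      1 ≤ j ∧ j ≤ m k := by
  constructor
  · rintro ⟨l, h1, h2⟩
    have hlk : l = k := by
      rcases lt_trichotomy l k with h | h | h
      · have := (startTime_strictMono m).monotone (Nat.succ_le_of_lt h)
        rw [Nat.succ_eq_add_one, startTime] at this
        omega
      · exact h
      · have := (startTime_strictMono m).monotone (Nat.succ_le_of_lt h)
        rw [Nat.succ_eq_add_one, startTime] at this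
        omega
    subst hlk
    omega
  · rintro ⟨h1, h2⟩
    exact ⟨k, by omega, by omega⟩

open Classical in
theorem count_dwell {lam : ℝ} (h0 : 0 ≤ lam) (h1 : lam ≤ 1) (k : ℕ) {j : ℕ}
    (hj : j ≤ dwell lam k + (k + 2)) :
    Nat.count (fun n => ∃ l, startTime (dwell lam) l < n ∧
      n ≤ startTime (dwell lam) l + dwell lam l) (startTime (dwell lam) k + j + 1) =
        dwellTotal lam k + min j (dwell lam k) := by
  induction k generalizing j with
  | zero =>
    induction j with
    | zero => simp [startTime, dwellTotal_zero, Nat.count_succ]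
    | succ j ih =>
      rw [Nat.count_succ, ← add_assoc, ih (by omega), add_assoc (startTime _ _) j 1]
      simp only [startTime_add_mem_iff _ hj]
      split_ifs <;> omega
  | succ k ihk =>
    induction j with
    | zero =>
      have h2 := ihk (j := dwell lam k + (k + 2)) le_rfl
      -- The arrival at a port is not a dwelling step, so the count equals that at the end of the
      -- previous excursion.
      rw [add_zero, Nat.count_succ]
      have h3 := startTime_add_mem_iff (dwell lam) (k := k + 1) (j := 0) (Nat.zero_le _)
      rw [add_zero] at h3
      simp only [h3]
      rw [startTime, ← add_assoc, h2, dwellTotal_succ h0 h1]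
      simp
    | succ j ih =>
      rw [Nat.count_succ, ← add_assoc, ih (by omega), add_assoc (startTime _ _) j 1]
      simp only [startTime_add_mem_iff _ hj]
      split_ifs <;> omega

theorem tendsto_two_div_natCast : Tendsto (fun k : ℕ => (2 : ℝ) / k) atTop (𝓝 0) :=
  tendsto_const_div_atTop_nhds_zero_nat 2

theorem tendsto_outTime_succ_div :
    Tendsto (fun k => (outTime (k + 1) : ℝ) / outTime k) atTop (𝓝 1) := by
  have h : Tendsto (fun k : ℕ => (1 : ℝ) + 2 / k) atTop (𝓝 (1 + 0)) :=
    tendsto_two_div_natCast.const_add 1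
  rw [add_zero] at h
  refine tendsto_of_tendsto_of_tendsto_of_le_of_le' tendsto_const_nhds h ?_ ?_
  all_goals
    filter_upwards [eventually_gt_atTop 0] with k hk
    have hkR : (0 : ℝ) < k := by exact_mod_cast hk
    have ho : (0 : ℝ) < outTime k := by exact_mod_cast hk.trans_le (le_outTime k)
    have h2 : (2 : ℝ) * outTime k = k * (k + 5) := by exact_mod_cast two_mul_outTime k
    have h3 : (outTime (k + 1) : ℝ) = outTime k + (k + 3) := by
      simp only [outTime]; push_cast; ring
  · rw [le_div_iff₀ ho, h3]; linarith
  · rw [div_le_iff₀ ho, h3, add_mul, one_mul, add_le_add_iff_left, div_mul_eq_mul_div,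
      le_div_iff₀ hkR, h2]
    nlinarith

/-- Without the floor the expression is exactly `lam` for `k > 0`; rounding costs at most `2 /
outTime k ≤ 2 / k`. The summand 1 in `k * (1 - lam) + 1` keeps the quotient defined for `lam = 1`,
where the dwelling time must outgrow `outTime`. -/
theorem tendsto_dwellTotal_scaled {lam : ℝ} (h0 : 0 ≤ lam) (h1 : lam ≤ 1) :
    Tendsto (fun k : ℕ => (dwellTotal lam k : ℝ) * (k * (1 - lam) + 1) / (k * outTime k)) atTop
      (𝓝 lam) := by
  rw [tendsto_iff_norm_sub_tendsto_zero]
  refine squeeze_zero' (Eventually.of_forall fun k => norm_nonneg _) ?_ tendsto_two_div_natCast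
  filter_upwards [eventually_gt_atTop 0] with k hk
  have hkR : (1 : ℝ) ≤ k := by exact_mod_cast hk
  have hok : (k : ℝ) ≤ outTime k := by exact_mod_cast le_outTime k
  have hl : 0 ≤ 1 - lam := by linarith
  have hD : 0 < k * (1 - lam) + 1 := by positivity
  have hD2 : k * (1 - lam) + 1 ≤ 2 * k := by nlinarith
  set x : ℝ := lam * k / (k * (1 - lam) + 1) * outTime k with hx
  have hx0 : 0 ≤ x := by positivity
  have hxD : x * (k * (1 - lam) + 1) = lam * (k * outTime k) := by rw [hx]; field_simp
  have hM1 : (dwellTotal lam k : ℝ) ≤ x := Nat.floor_le hx0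
  have hM2 : x < dwellTotal lam k + 1 := Nat.lt_floor_add_one x
  have hko : (0 : ℝ) < k * outTime k := by nlinarith
  have e : (dwellTotal lam k : ℝ) * (k * (1 - lam) + 1) / (k * outTime k) - lam
      = (dwellTotal lam k - x) * (k * (1 - lam) + 1) / (k * outTime k) := by
    rw [sub_mul, hxD, sub_div, mul_div_cancel_right₀ _ hko.ne']
  rw [e, norm_div, norm_mul, Real.norm_of_nonneg hD.le, Real.norm_of_nonneg hko.le,
    Real.norm_eq_abs, div_le_div_iff₀ hko (by linarith)]
  have habs : |(dwellTotal lam k : ℝ) - x| ≤ 1 := by rw [abs_le]; constructor <;> linarith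
  have h2 : |(dwellTotal lam k : ℝ) - x| * (k * (1 - lam) + 1) ≤ 1 * (2 * k) :=
    mul_le_mul habs hD2 hD.le zero_le_one
  nlinarith

theorem tendsto_dwell_denominator (lam : ℝ) :
    Tendsto (fun k : ℕ => (k * (1 - lam) + 1) / (k : ℝ)) atTop (𝓝 (1 - lam)) := by
  have h : Tendsto (fun k : ℕ => (1 - lam) + 1 / (k : ℝ)) atTop (𝓝 (1 - lam + 0)) :=
    (tendsto_const_div_atTop_nhds_zero_nat 1).const_add _
  rw [add_zero] at h
  refine h.congr' ?_
  filter_upwards [eventually_gt_atTop 0] with k hk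
  have hkR : (k : ℝ) ≠ 0 := by exact_mod_cast hk.ne'
  field_simp

/-- The proportion of the dwelling times tends to `lam`, with respect to any reasonable measure of
the total time. -/
theorem tendsto_dwell_ratio {lam : ℝ} (h0 : 0 ≤ lam) (h1 : lam ≤ 1) {o : ℕ → ℝ}
    (ho : Tendsto (fun k => o k / outTime k) atTop (𝓝 1)) :
    Tendsto (fun k => (dwellTotal lam k : ℝ) / (dwellTotal lam k + o k)) atTop (𝓝 lam) := by
  have hA := tendsto_dwellTotal_scaled h0 h1
  -- After scaling by `(k * (1 - lam) + 1) / (k * outTime k)` the two summands of the denominator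
  -- tend to `lam` and `1 - lam`, so the limit of the denominator is 1 even for `lam = 0` and `lam =
  -- 1`.
  have hq := ho.mul (tendsto_dwell_denominator lam)
  have h := hA.div (hA.add hq) (by norm_num)
  rw [one_mul, add_sub_cancel, div_one] at h
  refine h.congr' ?_
  filter_upwards [eventually_gt_atTop 0] with k hk
  have hkR : (0 : ℝ) < k := by exact_mod_cast hk
  have hok : (0 : ℝ) < outTime k := by exact_mod_cast hk.trans_le (le_outTime k)
  have hl : 0 ≤ 1 - lam := by linarith
  have hD : 0 < k * (1 - lam) + 1 := by positivity
  have e : (dwellTotal lam k : ℝ) * (k * (1 - lam) + 1) / (k * outTime k) +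
      o k / outTime k * ((k * (1 - lam) + 1) / k) =
      (dwellTotal lam k + o k) * ((k * (1 - lam) + 1) / (k * outTime k)) := by
    field_simp
  simp only [Pi.div_apply]
  rw [e, mul_div_assoc, mul_div_mul_right _ _ (by positivity)]

theorem tendsto_density_dwell {lam : ℝ} (h0 : 0 ≤ lam) (h1 : lam ≤ 1) :
    Tendsto (fun n : ℕ => (Set.ncard {i : ℕ | i ≤ n ∧ ∃ l, startTime (dwell lam) l < i ∧
      i ≤ startTime (dwell lam) l + dwell lam l} : ℝ) / n) atTop (𝓝 lam) := by
  classical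
  have hlow := tendsto_dwell_ratio h0 h1 (o := fun k => outTime (k + 1)) tendsto_outTime_succ_div
  have hup : Tendsto (fun k => (dwellTotal lam (k + 1) : ℝ) / (dwellTotal lam (k + 1) + outTime k))
      atTop (𝓝 lam) := by
    have h2 : Tendsto (fun k => (outTime (k - 1) : ℝ) / outTime k) atTop (𝓝 1) := by
      rw [← tendsto_add_atTop_iff_nat 1]
      have h3 := tendsto_outTime_succ_div.inv₀ one_ne_zero
      simpa only [inv_div, inv_one, Nat.add_sub_cancel] using h3
    exact (tendsto_add_atTop_iff_nat 1).2
      (tendsto_dwell_ratio h0 h1 (o := fun k => outTime (k - 1)) h2)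
  rw [Metric.tendsto_atTop]
  intro ε hε
  obtain ⟨k₀, hk₀⟩ := eventually_atTop.1 (((hlow.eventually (lt_mem_nhds (sub_lt_self lam hε))).and
    (hup.eventually (gt_mem_nhds (lt_add_of_pos_right lam hε)))).and (eventually_gt_atTop 0))
  refine ⟨startTime (dwell lam) k₀, fun n hn => ?_⟩
  obtain ⟨k, j, rfl, hj⟩ := exists_eq_startTime_add (dwell lam) n
  have hk : k₀ ≤ k := by
    have h2 : startTime (dwell lam) k₀ < startTime (dwell lam) (k + 1) := by
      rw [startTime]; omega
    exact Nat.lt_succ_iff.1 ((startTime_strictMono _).lt_iff_lt.1 h2)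
  obtain ⟨⟨hl, hu⟩, hkpos⟩ := hk₀ k hk
  have hset : Set.ncard {i : ℕ | i ≤ startTime (dwell lam) k + j ∧
      ∃ l, startTime (dwell lam) l < i ∧ i ≤ startTime (dwell lam) l + dwell lam l} =
      dwellTotal lam k + min j (dwell lam k) := by
    rw [← count_dwell h0 h1 k hj, Nat.count_eq_card_filter_range, ← Set.ncard_coe_finset]
    congr 1
    ext i
    simp
  rw [hset, startTime_dwell h0 h1]
  have hM := dwellTotal_succ h0 h1 k
  have hmin1 : min j (dwell lam k) ≤ j := min_le_left _ _
  have hmin2 : min j (dwell lam k) ≤ dwell lam k := min_le_right _ _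
  have hout : outTime (k + 1) = outTime k + (k + 3) := rfl
  -- The non-dwelling part of the time lies between `outTime k` and `outTime (k + 1)`, and `c`
  -- between consecutive dwelling totals. Since `x / (x + o)` increases in `x` and decreases in `o`,
  -- the proportion is squeezed between two sequences tending to `lam`.
  set c := dwellTotal lam k + min j (dwell lam k) with hc
  have hc1 : (dwellTotal lam k : ℝ) ≤ c := by exact_mod_cast Nat.le_add_right _ _
  have hc2 : (c : ℝ) ≤ dwellTotal lam (k + 1) := by exact_mod_cast (by omega)
  have hn1 : (c : ℝ) + outTime k ≤ ((dwellTotal lam k + outTime k + j : ℕ) : ℝ) := by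
    exact_mod_cast (by omega)
  have hn2 : ((dwellTotal lam k + outTime k + j : ℕ) : ℝ) ≤ c + outTime (k + 1) := by
    exact_mod_cast (by omega)
  have hok : (0 : ℝ) < outTime k := by exact_mod_cast hkpos.trans_le (le_outTime k)
  have hok' : (0 : ℝ) < outTime (k + 1) := by exact_mod_cast (by omega)
  have hM0 : (0 : ℝ) ≤ dwellTotal lam k := Nat.cast_nonneg _
  have hM0' : (0 : ℝ) ≤ dwellTotal lam (k + 1) := Nat.cast_nonneg _
  set n : ℝ := ((dwellTotal lam k + outTime k + j : ℕ) : ℝ) with hndef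
  have hnpos : 0 < n := by linarith
  have hlo : (dwellTotal lam k : ℝ) / (dwellTotal lam k + outTime (k + 1)) ≤ c / n := by
    rw [div_le_div_iff₀ (by linarith) hnpos]
    nlinarith
  have hhi : (c : ℝ) / n ≤ dwellTotal lam (k + 1) / (dwellTotal lam (k + 1) + outTime k) := by
    rw [div_le_div_iff₀ hnpos (by linarith)]
    nlinarith
  rw [Real.dist_eq, abs_lt]
  constructor <;> linarith

theorem corollary1p2 (lam : ℝ) (hlam : lam ∈ Set.Icc (0 : ℝ) 1) :
    ∃ (f : ℂ → ℂ) (U D : Set ℂ),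
      IsTranscendentalEntire f ∧ IsWanderingDomain f U ∧
      IsPlaneDomain D ∧ Bornology.IsBounded D ∧
      Tendsto (fun k : ℕ => (Set.ncard {n : ℕ | n ≤ k ∧ f^[n] '' U ⊆ D} : ℝ) / (k : ℝ))
        atTop (𝓝 lam) := by
  obtain ⟨f, U, D, h1, h2, h3, h4, h5⟩ := exists_wandering_of_dwelling (dwell lam)
  refine ⟨f, U, D, h1, h2, h3, h4, ?_⟩
  simp only [h5]
  exact tendsto_density_dwell hlam.1 hlam.2
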